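/- Let $\lambda,\mu>0$ and $n\ge 1$. Let $F_L$ be a probability distribution on $[0,\infty)$ with finite mean and $F_\Theta$ a probability distribution on $[0,\pi]$. Base stations form a homogeneous Poisson point process of density $\lambda$ in the plane, with points $\mathbf x_1,\mathbf x_2,\dots$ listed by increasing distance from the typical user, who is at the origin $O$. Independently, blockages are line segments whose centers form a homogeneous Poisson point process of density $\mu$ and whose lengths and orientations are i.i.d. with laws $F_L$ and $F_\Theta$, independent of each other and of the centers. The plane is rotated about $O$ so that $\mathbf x_n$ lies on the positive $x$-axis, and the orientations of the blockages are measured in this rotated frame. That is, the blockage process is independent of the rotated base station process. The $i$-th base station is LOS if no blockage meets the segment from $O$ to it, and the reliability with $n$-th order macro diversity, $p_{\mathrm R}$, is the probability that at least one of the $n$ nearest base stations is LOS. For $r_i\ge 0$, $\phi_i\in\mathbb R$, $\ell\ge 0$ and $\theta\in[0,\pi]$ let $\mathcal P_i$ be the parallelogram $\{s\,r_i(\cos\phi_i,\sin\phi_i)+t(\cos\theta,\sin\theta):0\le s\le 1,\ |t|\le \ell/2\}$. For $S\subseteq\{1,\dots,n\}$ let $A(S,\{r_i\},\{\phi_i\},\ell,\theta)$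 be the area of $\bigcup_{i\in S}\mathcal P_i$, and let $$\mathcal N(S,\{r_i\},\{\phi_i\})=\int_0^\infty\!\int_0^\pi A(S,\{r_i\},\{\phi_i\},\ell,\theta)\,F_\Theta(\mathrm d\theta)\,F_L(\mathrm d\ell).$$ Then $$p_{\mathrm R}=\frac{1}{(2\pi)^{n-1}}\int_{[0,2\pi]^{n-1}}\int_{(0,\infty)^n}K(\{r_i\},\{\phi_i\})\,f(r_1,\dots,r_n)\,\mathrm dr_1\cdots\mathrm dr_n\,\mathrm d\phi_1\cdots\mathrm d\phi_{n-1},$$ where $\phi_n=0$, $$K(\{r_i\},\{\phi_i\})=\sum_{\emptyset\ne S\subseteq\{1,\dots,n\}}(-1)^{|S|-1}\exp\bigl(-\mu\,\mathcal N(S,\{r_i\},\{\phi_i\})\bigr),$$ and $f(r_1,\dots,r_n)=(2\pi\lambda)^n r_1\cdots r_n\,e^{-\lambda\pi r_n^2}$ if $r_1\le\dots\le r_n$, and $f=0$ otherwise. The integrals defining $\mathcal N$ and $p_{\mathrm R}$ converge absolutely. If $F_\Theta$ is the uniform distribution on $[0,\pi]$, the same formula holds for the reliability without the rotation, that is, when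 the base station process and the blockage process are independent in a fixed frame. -/

import Mathlib

open MeasureTheory ProbabilityTheory
open scoped ENNReal NNReal

noncomputable section

/-- `X 0, X 1, …` is an enumeration of a Poisson point process on `E` with intensity measure `ν`:
the numbers of points in pairwise disjoint measurable sets `B 0, …, B (m-1)` of finite intensity
are independent, and the number of points in `B i` is Poisson with mean `ν (B i)`. -/
structure IsPoissonProcess {Ω E : Type*} [MeasurableSpace Ω] [MeasurableSpace E]
    (P : Measure Ω) (ν : Measure E) (X : ℕ → Ω → E) : Prop where
  measurable : ∀ j, Measurable (X j)
  law : ∀ (m : ℕ) (B : Fin m → Set E), (∀ i, MeasurableSet (B i)) →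
    Pairwise (fun i j => Disjoint (B i) (B j)) → (∀ i, ν (B i) < ∞) → ∀ k : Fin m → ℕ,
      P {ω | ∀ i, {j | X j ω ∈ B i}.encard = (k i : ℕ∞)} =
        ∏ i, poissonMeasure (ν (B i)).toNNReal {k i}

/-- The unit vector of orientation `φ`; the plane is identified with `ℂ`. -/
def unitVec (φ : ℝ) : ℂ := ⟨Real.cos φ, Real.sin φ⟩

/-- The link from the typical user (at the origin) to a base station at `x`. -/
def link (x : ℂ) : Set ℂ := segment ℝ 0 x

/-- The linear blockage with center `c`, length `ℓ` and orientation `θ`. -/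
def blockage (c : ℂ) (ℓ θ : ℝ) : Set ℂ :=
  segment ℝ (c - ((ℓ / 2 : ℝ) : ℂ) * unitVec θ) (c + ((ℓ / 2 : ℝ) : ℂ) * unitVec θ)

/-- The network: base stations `X 0, X 1, …` form a homogeneous Poisson process of density `lam`
and are listed by increasing distance from the origin; blockage centers `C k` form a homogeneous
Poisson process of density `mu`; the pairs (length, orientation) `(L k, T k)` are i.i.d. with law
`FL ⊗ FT` and independent of the centers; blockages and base stations are independent. -/
structure IsCellularNetwork {Ω : Type*} [MeasurableSpace Ω] (P : Measure Ω) (lam mu : ℝ)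
    (FL FT : Measure ℝ) (X C : ℕ → Ω → ℂ) (L T : ℕ → Ω → ℝ) : Prop where
  stations : IsPoissonProcess P (ENNReal.ofReal lam • (volume : Measure ℂ)) X
  ordered : ∀ᵐ ω ∂P, Monotone (fun i => ‖X i ω‖)
  centers : IsPoissonProcess P (ENNReal.ofReal mu • (volume : Measure ℂ)) C
  measurable_length : ∀ k, Measurable (L k)
  measurable_orientation : ∀ k, Measurable (T k)
  marks_law : ∀ k, P.map (fun ω => (L k ω, T k ω)) = FL.prod FT
  marks_indep : iIndepFun (fun k ω => (L k ω, T k ω)) P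
  centers_indep_marks :
    IndepFun (fun ω (k : ℕ) => C k ω) (fun ω (k : ℕ) => (L k ω, T k ω)) P
  stations_indep_blockages :
    IndepFun (fun ω (i : ℕ) => X i ω) (fun ω (k : ℕ) => (C k ω, L k ω, T k ω)) P

/-- The link to a base station at `x` is line-of-sight: no blockage meets it. -/
def IsLOS (x : ℂ) (c : ℕ → ℂ) (ℓ θ : ℕ → ℝ) : Prop :=
  ∀ k, Disjoint (link x) (blockage (c k) (ℓ k) (θ k))

/-- The reliability: the probability that at least one of the `n` links to the stations
`Y 0, …, Y (n-1)` is line-of-sight. -/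
def reliability {Ω : Type*} [MeasurableSpace Ω] (P : Measure Ω) (n : ℕ)
    (Y C : ℕ → Ω → ℂ) (L T : ℕ → Ω → ℝ) : ℝ :=
  P.real (⋃ i : Fin n, {ω | IsLOS (Y i ω) (fun k => C k ω) (fun k => L k ω) (fun k => T k ω)})

/-- The image of `w` under the rotation about the origin that takes `z ≠ 0` to the positive
`x`-axis. -/
def rotateToAxis (z w : ℂ) : ℂ := w * ((starRingEnd ℂ) z / ((‖z‖ : ℝ) : ℂ))

/-- The parallelogram spanned by a side `Y` of length `r` and orientation `φ` starting at the
origin, and a side `AB` of length `ℓ` and orientation `θ` with midpoint at the origin. -/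
def parallelogram (r φ ℓ θ : ℝ) : Set ℂ :=
  {z | ∃ s ∈ Set.Icc (0 : ℝ) 1, ∃ t ∈ Set.Icc (-(ℓ / 2)) (ℓ / 2),
    z = ((s * r : ℝ) : ℂ) * unitVec φ + ((t : ℝ) : ℂ) * unitVec θ}

/-- The area of the union of the parallelograms indexed by `S`. -/
def unionArea {n : ℕ} (S : Finset (Fin n)) (r φ : Fin n → ℝ) (ℓ θ : ℝ) : ℝ :=
  (volume : Measure ℂ).real (⋃ i ∈ S, parallelogram (r i) (φ i) ℓ θ)

/-- The mean of the area of the union over the length and the orientation of a blockage. -/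
def meanUnionArea (FL FT : Measure ℝ) {n : ℕ} (S : Finset (Fin n)) (r φ : Fin n → ℝ) : ℝ :=
  ∫ p in Set.Ici (0 : ℝ) ×ˢ Set.Icc (0 : ℝ) Real.pi, unionArea S r φ p.1 p.2 ∂(FL.prod FT)

/-- The inclusion-exclusion sum over the nonempty sets `S` of links. -/
def inclExclSum (mu : ℝ) (FL FT : Measure ℝ) {n : ℕ} (r φ : Fin n → ℝ) : ℝ :=
  ∑ S ∈ (Finset.univ : Finset (Fin n)).powerset.filter (fun S => S.Nonempty),
    (-1 : ℝ) ^ (S.card - 1) * Real.exp (-(mu * meanUnionArea FL FT S r φ))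

open Classical in
/-- The joint density of the distances to the `n` nearest base stations. -/
def distanceDensity (lam : ℝ) {n : ℕ} (hn : 0 < n) (r : Fin n → ℝ) : ℝ :=
  if Monotone r then
    (2 * Real.pi * lam) ^ n * (∏ i, r i) *
      Real.exp (-(lam * Real.pi * r ⟨n - 1, Nat.sub_lt hn one_pos⟩ ^ 2))
  else 0

/-- The angles of all `n` links, given those of the first `n - 1`: the last link is on the
`x`-axis. -/
def extendAngles {n : ℕ} (φ : Fin (n - 1) → ℝ) (i : Fin n) : ℝ :=
  if h : (i : ℕ) < n - 1 then φ ⟨i, h⟩ else 0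

/-- The box `[0, 2π]^(n-1)` of angles. -/
def angleBox (n : ℕ) : Set (Fin (n - 1) → ℝ) :=
  Set.pi Set.univ (fun _ => Set.Icc 0 (2 * Real.pi))

/-- The set of positive distance vectors. -/
def positiveOrthant (n : ℕ) : Set (Fin n → ℝ) := {r | ∀ i, 0 < r i}

/-- The average of the inclusion-exclusion sum over the distances and the uniform angles. -/
def averagedSum (lam mu : ℝ) (FL FT : Measure ℝ) {n : ℕ} (hn : 0 < n) : ℝ :=
  1 / (2 * Real.pi) ^ (n - 1) *
    ∫ φ in angleBox n, ∫ r in positiveOrthant n,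
      inclExclSum mu FL FT r (extendAngles φ) * distanceDensity lam hn r

end

set_option linter.unusedSectionVars false

/-! Freeze the stations first. A blockage is a point (center, length, orientation) of an
independently marked Poisson process, and the links of `S` are all LOS iff no such point falls in
the set `D` of blockages that hit one of them. For given `ℓ` and `θ` the centers that hit link `i`
fill the parallelogram `𝒫_i` (`mem_parallelogram_iff`), so by Fubini `D` has intensity `μ 𝒩(S)` and
is empty with probability `exp(-μ 𝒩(S))`. This void probability
(`IsPoissonProcess.measure_forall_notMem_marked`) follows from the generating functional
`IsPoissonProcess.lintegral_iInf_prod`. Inclusion-exclusion over `S` gives `K`, and independence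
makes the reliability the mean of `K` over the stations.

The `n` nearest stations have density `λ^n exp(-λπ‖x_n‖²)` on strictly increasing norms
(`IsPoissonProcess.map_eq_withDensity_nearestPointsDensity`). Only the bound from below is proved
locally: on products of separated annuli the law of the counts gives the weight of a box up to a
factor that tends to 1. Equality is then automatic, since both measures have mass 1
(`lintegral_nearestPointsDensity`).

In polar coordinates this density becomes `f` times uniform angles. If the integrand depends only on
the angles relative to the last one, the last angle integrates to `2π` and the prefactor
`(2π)^{-(n-1)}` remains (`IsCellularNetwork.lintegral_stations`). After the rotation to the axis the
integrand is of this kind by construction; without it, uniform orientations suffice, because the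
mean union area is then invariant under turning all links together. -/

/-! ### Poisson processes: counts, generating functional, void probabilities -/

theorem measurableSet_encard_eq {Ω E : Type*} [MeasurableSpace Ω] [MeasurableSpace E]
    {X : ℕ → Ω → E} (hX : ∀ j, Measurable (X j)) {B : Set E} (hB : MeasurableSet B) (k : ℕ) :
    MeasurableSet {ω | {j | X j ω ∈ B}.encard = (k : ℕ∞)} := by
  have h : {ω | {j | X j ω ∈ B}.encard = (k : ℕ∞)} =
      ⋃ s : Finset ℕ, {ω | s.card = k ∧ ∀ j, X j ω ∈ B ↔ j ∈ s} := by
    ext ω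
    simp only [Set.mem_ofPred_eq, Set.mem_iUnion]
    constructor
    · intro h
      have hf : {j | X j ω ∈ B}.Finite := Set.finite_of_encard_eq_coe h
      refine ⟨hf.toFinset, ?_, by simp⟩
      rw [hf.encard_eq_coe_toFinset_card] at h
      exact_mod_cast h
    · rintro ⟨s, hs, h⟩
      have : {j | X j ω ∈ B} = (s : Set ℕ) := by ext j; simp [h]
      rw [this, Set.encard_coe_eq_coe_finsetCard, hs]
  rw [h]
  refine MeasurableSet.iUnion fun s => (MeasurableSet.const _).inter
    (s₂ := {ω | ∀ j, X j ω ∈ B ↔ j ∈ s}) ?_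
  rw [Set.ofPred_forall]
  exact MeasurableSet.iInter fun j => (hX j hB).iff (MeasurableSet.const _)

namespace IsPoissonProcess

variable {Ω E : Type*} [MeasurableSpace Ω] [MeasurableSpace E] {P : Measure Ω} {ν : Measure E}
  {X : ℕ → Ω → E}

theorem law_fintype {ι : Type*} [Fintype ι] (hX : IsPoissonProcess P ν X)
    {B : ι → Set E} (hB : ∀ i, MeasurableSet (B i))
    (hd : Pairwise fun i j => Disjoint (B i) (B j)) (hf : ∀ i, ν (B i) < ∞) (k : ι → ℕ) :
    P {ω | ∀ i, {j | X j ω ∈ B i}.encard = (k i : ℕ∞)} =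
      ∏ i, poissonMeasure (ν (B i)).toNNReal {k i} := by
  let e := Fintype.equivFin ι
  have h := hX.law (Fintype.card ι) (fun i => B (e.symm i)) (fun i => hB _)
    (fun i j hij => hd (fun h => hij (e.symm.injective h))) (fun i => hf _) (fun i => k (e.symm i))
  rw [e.symm.prod_comp (fun i => poissonMeasure (ν (B i)).toNNReal {k i})] at h
  rw [← h]
  congr 1
  ext ω
  exact (e.symm.forall_congr_right
    (q := fun i => {j | X j ω ∈ B i}.encard = (k i : ℕ∞))).symm

/-- The events that prescribe all counts are countably many and disjoint, and their probabilities
are the point masses of the product of Poisson laws. These sum to 1, so the counts are almost surely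
finite. `F` is constant on each event, hence needs no measurability of its own. -/
theorem lintegral_counts {ι : Type*} [Fintype ι] [IsProbabilityMeasure P]
    (hX : IsPoissonProcess P ν X)
    {B : ι → Set E} (hB : ∀ i, MeasurableSet (B i))
    (hd : Pairwise fun i j => Disjoint (B i) (B j)) (hf : ∀ i, ν (B i) < ∞)
    {F : Ω → ℝ≥0∞} {G : (ι → ℕ) → ℝ≥0∞}
    (hFG : ∀ ω k, (∀ i, {j | X j ω ∈ B i}.encard = (k i : ℕ∞)) → F ω = G k) :
    ∫⁻ ω, F ω ∂P = ∫⁻ k, G k ∂(Measure.pi fun i => poissonMeasure (ν (B i)).toNNReal) := by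
  classical
  set A : (ι → ℕ) → Set Ω := fun k => {ω | ∀ i, {j | X j ω ∈ B i}.encard = (k i : ℕ∞)}
  have hA : ∀ k, MeasurableSet (A k) := fun k => by
    simp only [A, Set.ofPred_forall]
    exact MeasurableSet.iInter fun i => measurableSet_encard_eq hX.measurable (hB i) (k i)
  have hAd : Pairwise (Function.onFun Disjoint A) := by
    intro k l hkl
    refine Set.disjoint_left.2 fun ω hk hl => hkl ?_
    ext i
    have := (hk i).symm.trans (hl i)
    exact_mod_cast this
  have hPA : ∀ k, P (A k) = (Measure.pi fun i => poissonMeasure (ν (B i)).toNNReal) {k} := by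
    intro k
    rw [Measure.pi_singleton]
    exact hX.law_fintype hB hd hf k
  have huniv : P (⋃ k, A k) = 1 := by
    rw [measure_iUnion hAd hA]
    simp_rw [hPA]
    rw [← measure_iUnion (fun i j hij => by simpa [Function.onFun] using hij)
      (fun _ => measurableSet_singleton _), Set.iUnion_of_singleton, measure_univ]
  have hae : ∀ᵐ ω ∂P, ω ∈ ⋃ k, A k :=
    (prob_compl_eq_zero_iff (MeasurableSet.iUnion hA)).2 huniv
  rw [← setLIntegral_univ, ← setLIntegral_congr (s := ⋃ k, A k)
    (Filter.eventuallyEq_univ.2 hae), lintegral_iUnion hA hAd, lintegral_countable']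
  refine tsum_congr fun k => ?_
  rw [setLIntegral_congr_fun (g := fun _ => G k) (hA k) (fun ω hω => hFG ω k hω),
    setLIntegral_const, hPA]

end IsPoissonProcess

theorem lintegral_pow_poissonMeasure (r : ℝ≥0) {g : ℝ≥0∞} (hg : g ≤ 1) :
    ∫⁻ k, g ^ k ∂(poissonMeasure r) = ENNReal.ofReal (Real.exp (-(r * (1 - g).toReal))) := by
  lift g to ℝ≥0 using (hg.trans_lt ENNReal.one_lt_top).ne
  have hg' : g ≤ 1 := by exact_mod_cast hg
  have h1 : ((1 : ℝ≥0∞) - g).toReal = 1 - (g : ℝ) := by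
    rw [ENNReal.toReal_sub_of_le hg (by simp)]; simp
  have hs : HasSum (fun n : ℕ => Real.exp (-r) * ((r * g : ℝ) ^ n / n.factorial))
      (Real.exp (-r) * Real.exp (r * g)) := by
    have := (NormedSpace.expSeries_div_hasSum_exp (r * g : ℝ)).mul_left (Real.exp (-r))
    rwa [← Real.exp_eq_exp_ℝ] at this
  rw [lintegral_countable', h1, show -((r : ℝ) * (1 - g)) = -r + r * g by ring, Real.exp_add,
    ← hs.tsum_eq, ENNReal.ofReal_tsum_of_nonneg (fun n => by positivity) hs.summable]
  refine tsum_congr fun n => ?_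
  rw [poissonMeasure_singleton, ← ENNReal.ofReal_coe_nnreal,
    ← ENNReal.ofReal_pow g.coe_nonneg, ← ENNReal.ofReal_mul (by positivity)]
  congr 1
  rw [mul_pow]; ring

/-- Factors at most 1 make the partial products antitone, and they are constant once all the
finitely many points in the sets `B i` are listed. The infimum thus serves as an infinite product
that always exists. -/
theorem iInf_prod_range_eq_prod_pow {E ι : Type*} [Fintype ι] {x : ℕ → E} {B : ι → Set E}
    [∀ i, DecidablePred (· ∈ B i)]
    {g : ι → ℝ≥0∞} (hg : ∀ i, g i ≤ 1) {k : ι → ℕ}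
    (hk : ∀ i, {j | x j ∈ B i}.encard = (k i : ℕ∞)) :
    ⨅ N : ℕ, ∏ j ∈ Finset.range N, ∏ i, (if x j ∈ B i then g i else 1) = ∏ i, g i ^ k i := by
  classical
  have hfin : ∀ i, {j | x j ∈ B i}.Finite := fun i => Set.finite_of_encard_eq_coe (hk i)
  have hcard : ∀ i, (hfin i).toFinset.card = k i := fun i => by
    have := hk i
    rw [(hfin i).encard_eq_coe_toFinset_card] at this
    exact_mod_cast this
  obtain ⟨M, hM⟩ := (Finset.univ.biUnion fun i => (hfin i).toFinset).exists_nat_subset_range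
  have hMi : ∀ i j, x j ∈ B i → j < M := fun i j hj => by
    have := @hM j
    simp only [Finset.mem_biUnion, Finset.mem_univ, true_and, Set.Finite.mem_toFinset,
      Set.mem_ofPred_eq, Finset.mem_range, forall_exists_index] at this
    exact this i hj
  have heq : ∀ N, M ≤ N →
      ∏ j ∈ Finset.range N, ∏ i, (if x j ∈ B i then g i else 1) = ∏ i, g i ^ k i := by
    intro N hN
    rw [Finset.prod_comm]
    refine Finset.prod_congr rfl fun i _ => ?_
    rw [Finset.prod_ite, Finset.prod_const, Finset.prod_const_one, mul_one, ← hcard i]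
    congr 2
    ext j
    simp only [Finset.mem_filter, Finset.mem_range, Set.Finite.mem_toFinset, Set.mem_ofPred_eq,
      and_iff_right_iff_imp]
    exact fun h => (hMi i j h).trans_le hN
  have hanti : Antitone fun N : ℕ =>
      ∏ j ∈ Finset.range N, ∏ i, (if x j ∈ B i then g i else 1) := by
    refine antitone_nat_of_succ_le fun N => ?_
    rw [Finset.prod_range_succ]
    refine mul_le_of_le_one_right' (Finset.prod_le_one' fun i _ => ?_)
    split_ifs
    exacts [hg i, le_rfl]
  refine le_antisymm (iInf_le_of_le M (heq M le_rfl).le) (le_iInf fun N => ?_)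
  rw [← heq (max N M) (le_max_right _ _)]
  exact hanti (le_max_left _ _)

namespace IsPoissonProcess

variable {Ω E : Type*} [MeasurableSpace Ω] [MeasurableSpace E] {P : Measure Ω} {ν : Measure E}
  {X : ℕ → Ω → E}

/-- The infinite product is `∏ (1 - a) ^ N_a`, with `N_a` the number of points in the level set of
the value `a`. These counts are independent and Poisson, so the mean factors into the terms `exp(-a
ν(B a))`. -/
theorem lintegral_iInf_prod_simpleFunc [IsProbabilityMeasure P] (hX : IsPoissonProcess P ν X)
    (p : SimpleFunc E ℝ≥0∞) (hp : ∀ x, p x ≤ 1) (hpi : ∫⁻ x, p x ∂ν ≠ ∞) :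
    ∫⁻ ω, ⨅ N : ℕ, ∏ j ∈ Finset.range N, (1 - p (X j ω)) ∂P =
      ENNReal.ofReal (Real.exp (-(∫⁻ x, p x ∂ν).toReal)) := by
  classical
  -- The value 0 is left out: its level set may have infinite intensity, and it contributes only
  -- factors 1. The other level sets are finite by Markov's inequality.
  obtain ⟨S, hS⟩ : ∃ S, S = p.range.filter (· ≠ 0) := ⟨_, rfl⟩
  have hmem : ∀ a : S, (a : ℝ≥0∞) ∈ p.range.filter (· ≠ 0) := fun a => hS ▸ a.2
  let B : S → Set E := fun a => p ⁻¹' {a.1}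
  have hrange : ∀ a : S, (a : ℝ≥0∞) ≤ 1 := fun a => by
    obtain ⟨x, hx⟩ := SimpleFunc.mem_range.1 (Finset.mem_filter.1 (hmem a)).1
    exact hx ▸ hp x
  have h0 : ∀ a : S, (a : ℝ≥0∞) ≠ 0 := fun a => (Finset.mem_filter.1 (hmem a)).2
  have hB : ∀ a, MeasurableSet (B a) := fun a => p.measurableSet_fiber a
  have hd : Pairwise fun i j => Disjoint (B i) (B j) := fun a b hab =>
    Disjoint.preimage _ (Set.disjoint_singleton.2 fun h => hab (Subtype.ext h))
  have hfin : ∀ a, ν (B a) < ∞ := fun a => by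
    refine lt_top_iff_ne_top.2 fun htop => hpi (top_le_iff.1 ?_)
    calc ∞ = (a : ℝ≥0∞) * ν (B a) := by rw [htop, ENNReal.mul_top (h0 a)]
      _ ≤ ∫⁻ x, p x ∂ν := by
        refine le_trans ?_ (mul_meas_ge_le_lintegral p.measurable a.1)
        gcongr
        intro x hx
        exact le_of_eq hx.symm
  have hint : (∫⁻ x, p x ∂ν) = ∑ a : S, (a : ℝ≥0∞) * ν (B a) := by
    refine (SimpleFunc.lintegral_eq_lintegral p ν).trans ?_
    unfold SimpleFunc.lintegral
    simp only [B]
    rw [Finset.sum_coe_sort S (fun a => a * ν (p ⁻¹' {a})), hS, Finset.sum_filter_of_ne]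
    rintro a - ha rfl
    simp at ha
  have hprod : ∀ x, 1 - p x = ∏ a : S, (if x ∈ B a then 1 - (a : ℝ≥0∞) else 1) := by
    intro x
    simp only [B]
    rw [Finset.prod_coe_sort S
      (fun a => if x ∈ p ⁻¹' {a} then 1 - a else 1)]
    simp only [Set.mem_preimage, Set.mem_singleton_iff]
    rw [Finset.prod_ite_eq]
    rw [hS]
    split_ifs with h
    · rfl
    · simp only [Finset.mem_filter, SimpleFunc.mem_range_self, true_and, not_not] at h
      simp [h]
  rw [hX.lintegral_counts hB hd hfin (G := fun k => ∏ a : S, (1 - (a : ℝ≥0∞)) ^ k a)]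
  · rw [lintegral_prod_eq_prod_lintegral_of_indepFun Finset.univ
      (fun (a : S) (k : S → ℕ) => (1 - (a : ℝ≥0∞)) ^ k a)]
    · have : ∀ a : S, ∫⁻ k, (1 - (a : ℝ≥0∞)) ^ k a
          ∂(Measure.pi fun a : S => poissonMeasure (ν (B a)).toNNReal) =
          ENNReal.ofReal (Real.exp (-((a : ℝ≥0∞) * ν (B a)).toReal)) := by
        intro a
        have h1 := (measurePreserving_eval
          (fun a : S => poissonMeasure (ν (B a)).toNNReal) a).lintegral_comp
          (f := fun n => (1 - (a : ℝ≥0∞)) ^ n) (by fun_prop)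
        change ∫⁻ k : S → ℕ, (1 - (a : ℝ≥0∞)) ^ k a ∂_ = _ at h1
        rw [h1, lintegral_pow_poissonMeasure _ tsub_le_self,
          ENNReal.sub_sub_cancel ENNReal.one_ne_top (hrange a), ENNReal.toReal_mul, mul_comm]
        rfl
      simp_rw [this]
      rw [← ENNReal.ofReal_prod_of_nonneg fun _ _ => (Real.exp_pos _).le, ← Real.exp_sum, hint,
        ENNReal.toReal_sum, Finset.sum_neg_distrib]
      exact fun a _ => ENNReal.mul_ne_top ((hrange a).trans_lt ENNReal.one_lt_top).ne (hfin a).ne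
    · exact iIndepFun_pi (X := fun (a : S) (n : ℕ) => (1 - (a : ℝ≥0∞)) ^ n)
        fun a => Measurable.aemeasurable (by fun_prop)
    · exact fun a => Measurable.comp (g := fun n : ℕ => (1 - (a : ℝ≥0∞)) ^ n) (by fun_prop)
        (measurable_pi_apply a)
  · intro ω k hk
    simp_rw [hprod]
    exact iInf_prod_range_eq_prod_pow (fun a => tsub_le_self) hk

/-- The probability generating functional of a Poisson process. -/
theorem lintegral_iInf_prod [IsProbabilityMeasure P] (hX : IsPoissonProcess P ν X)
    {p : E → ℝ≥0∞} (hpm : Measurable p) (hp : ∀ x, p x ≤ 1) (hpi : ∫⁻ x, p x ∂ν ≠ ∞) :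
    ∫⁻ ω, ⨅ N : ℕ, ∏ j ∈ Finset.range N, (1 - p (X j ω)) ∂P =
      ENNReal.ofReal (Real.exp (-(∫⁻ x, p x ∂ν).toReal)) := by
  set q := SimpleFunc.eapprox p
  have hqp : ∀ n x, q n x ≤ p x := fun n x => by
    rw [← SimpleFunc.iSup_eapprox_apply hpm x]
    exact le_iSup (fun n => SimpleFunc.eapprox p n x) n
  have hq1 : ∀ n x, q n x ≤ 1 := fun n x => (hqp n x).trans (hp x)
  have hqi : ∀ n, ∫⁻ x, q n x ∂ν ≠ ∞ := fun n => ne_top_of_le_ne_top hpi (lintegral_mono (hqp n))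
  have hmono : ∀ x, Monotone fun n => q n x := fun x m n h => SimpleFunc.monotone_eapprox p h x
  have hqt : ∀ x, Filter.Tendsto (fun n => q n x) Filter.atTop (nhds (p x)) := fun x => by
    rw [← SimpleFunc.iSup_eapprox_apply hpm x]
    exact tendsto_atTop_iSup (hmono x)
  have hXm := hX.measurable
  have hpoint : ∀ ω, ⨅ N : ℕ, ∏ j ∈ Finset.range N, (1 - p (X j ω)) =
      ⨅ n : ℕ, ⨅ N : ℕ, ∏ j ∈ Finset.range N, (1 - q n (X j ω)) := by
    intro ω
    -- With the infima exchanged, `N` is fixed and the finite product is continuous in the values of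
    -- `q n`, which increase to `p`.
    rw [iInf_comm]
    congr 1
    ext N
    refine tendsto_nhds_unique ?_ (tendsto_atTop_iInf ?_)
    · refine ENNReal.tendsto_finsetProd_of_ne_top _ (fun j _ => ?_) (fun j _ => ?_)
      · exact ENNReal.Tendsto.sub tendsto_const_nhds (hqt _) (Or.inl ENNReal.one_ne_top)
      · exact (tsub_le_self.trans_lt ENNReal.one_lt_top).ne
    · intro m n h
      exact Finset.prod_le_prod' fun j _ => tsub_le_tsub_left (hmono _ h) _
  simp_rw [hpoint]
  rw [lintegral_iInf]
  · simp_rw [fun n => hX.lintegral_iInf_prod_simpleFunc (q n) (hq1 n) (hqi n)]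
    refine tendsto_nhds_unique (tendsto_atTop_iInf ?_) ?_
    · intro m n h
      dsimp only
      gcongr
      · exact hqi n
      · exact hmono _ h
    · have h1 : Filter.Tendsto (fun n => ∫⁻ x, q n x ∂ν) Filter.atTop (nhds (∫⁻ x, p x ∂ν)) :=
        lintegral_tendsto_of_tendsto_of_monotone (fun n => (q n).measurable.aemeasurable)
          (Filter.Eventually.of_forall hmono) (Filter.Eventually.of_forall hqt)
      have h2 := (ENNReal.tendsto_toReal hpi).comp h1
      exact (ENNReal.continuous_ofReal.tendsto _).comp
        ((Real.continuous_exp.tendsto _).comp h2.neg)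
  · intro n
    refine Measurable.iInf fun N => Finset.measurable_fun_prod _ fun j _ => ?_
    exact measurable_const.sub ((q n).measurable.comp (hXm j))
  · intro m n h ω
    exact iInf_mono fun N => Finset.prod_le_prod' fun j _ => tsub_le_tsub_left (hmono _ h) _
  · refine ne_top_of_le_ne_top (b := 1) ENNReal.one_ne_top ?_
    refine (lintegral_mono fun ω => (iInf_le _ 0)).trans ?_
    simp

end IsPoissonProcess

/-- The void probability of an independently marked Poisson process. -/
theorem IsPoissonProcess.measure_forall_notMem_marked {Ω E M : Type*} [MeasurableSpace Ω]
    [MeasurableSpace E] [MeasurableSpace M] {P : Measure Ω} [IsProbabilityMeasure P]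
    {ν : Measure E} {Q : Measure M} [IsProbabilityMeasure Q] {C : ℕ → Ω → E} {K : ℕ → Ω → M}
    (hC : IsPoissonProcess P ν C) (hK : ∀ k, Measurable (K k)) (hlaw : ∀ k, P.map (K k) = Q)
    (hindep : iIndepFun K P) (hCK : IndepFun (fun ω k => C k ω) (fun ω k => K k ω) P)
    {D : Set (E × M)} (hD : MeasurableSet D) (hfin : (ν.prod Q) D ≠ ∞) :
    P {ω | ∀ k, (C k ω, K k ω) ∉ D} = ENNReal.ofReal (Real.exp (-((ν.prod Q) D).toReal)) := by
  have hCm := hC.measurable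
  have hCm' : Measurable fun ω k => C k ω := measurable_pi_lambda _ hCm
  have hKm' : Measurable fun ω k => K k ω := measurable_pi_lambda _ hK
  set p : E → ℝ≥0∞ := fun c => Q (Prod.mk c ⁻¹' D)
  have hpm : Measurable p := measurable_measure_prodMk_left hD
  have hDN : ∀ N : ℕ, MeasurableSet
      {q : (ℕ → E) × (ℕ → M) | ∀ k < N, (q.1 k, q.2 k) ∉ D} := fun N => by
    simp only [Set.ofPred_forall]
    refine MeasurableSet.iInter fun k => MeasurableSet.iInter fun _ => ?_
    exact MeasurableSet.compl (s := (fun q : (ℕ → E) × (ℕ → M) => (q.1 k, q.2 k)) ⁻¹' D)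
      (hD.preimage (by fun_prop))
  -- With the centers frozen, the first `N` marks are independent, and each avoids its section of
  -- `D` with probability `1 - p`. Letting `N` grow produces the generating functional at `p`.
  have hN : ∀ N : ℕ, P {ω | ∀ k < N, (C k ω, K k ω) ∉ D} =
      ∫⁻ ω, ∏ k ∈ Finset.range N, (1 - p (C k ω)) ∂P := by
    intro N
    have h1 := (indepFun_iff_map_prod_eq_prod_map_map hCm'.aemeasurable hKm'.aemeasurable).1 hCK
    have h2 : P {ω | ∀ k < N, (C k ω, K k ω) ∉ D} =
        (P.map fun ω => ((fun k => C k ω), (fun k => K k ω)))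
          {q : (ℕ → E) × (ℕ → M) | ∀ k < N, (q.1 k, q.2 k) ∉ D} := by
      rw [Measure.map_apply (hCm'.prodMk hKm') (hDN N)]
      rfl
    have : IsProbabilityMeasure (P.map fun ω k => K k ω) :=
      Measure.isProbabilityMeasure_map hKm'.aemeasurable
    rw [h2, h1, Measure.prod_apply (hDN N), lintegral_map (measurable_measure_prodMk_left (hDN N))
      hCm']
    refine lintegral_congr fun ω => ?_
    rw [Measure.map_apply hKm' (measurable_prodMk_left (hDN N))]
    have h3 : (fun ω k => K k ω) ⁻¹' (Prod.mk (fun k => C k ω) ⁻¹'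
        {q : (ℕ → E) × (ℕ → M) | ∀ k < N, (q.1 k, q.2 k) ∉ D}) =
        ⋂ k ∈ Finset.range N, K k ⁻¹' (Prod.mk (C k ω) ⁻¹' D)ᶜ := by
      ext ω'
      simp
    rw [h3, hindep.measure_inter_preimage_eq_mul _
      (fun k _ => (measurable_prodMk_left hD).compl)]
    refine Finset.prod_congr rfl fun k _ => ?_
    rw [← Measure.map_apply (hK k) (measurable_prodMk_left hD).compl, hlaw,
      prob_compl_eq_one_sub (measurable_prodMk_left hD)]
  have hset : {ω | ∀ k, (C k ω, K k ω) ∉ D} = ⋂ N : ℕ, {ω | ∀ k < N, (C k ω, K k ω) ∉ D} := by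
    ext ω
    simp only [Set.mem_ofPred_eq, Set.mem_iInter]
    exact ⟨fun h N k _ => h k, fun h k => h (k + 1) k k.lt_succ_self⟩
  have hpi : ∫⁻ c, p c ∂ν = (ν.prod Q) D := (Measure.prod_apply hD).symm
  rw [hset, Antitone.measure_iInter]
  · simp_rw [hN]
    rw [← lintegral_iInf, hC.lintegral_iInf_prod hpm (fun c => prob_le_one) (hpi ▸ hfin), hpi]
    · exact fun N => Finset.measurable_fun_prod _ fun k _ =>
        measurable_const.sub (hpm.comp (hCm k))
    · refine antitone_nat_of_succ_le fun N ω => ?_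
      simp only [Finset.prod_range_succ]
      exact mul_le_of_le_one_right' tsub_le_self
    · simp
  · exact fun m n h ω hω k hk => hω k (hk.trans_le h)
  · exact fun N => ((hDN N).preimage (hCm'.prodMk hKm')).nullMeasurableSet
  · exact ⟨0, measure_ne_top _ _⟩

/-! ### Geometry of links, blockages and parallelograms -/

theorem continuous_unitVec : Continuous unitVec := by
  have : unitVec = fun φ => ((Real.cos φ : ℝ) : ℂ) + ((Real.sin φ : ℝ) : ℂ) * Complex.I := by
    ext φ; simp [unitVec, Complex.ext_iff, Complex.cos_ofReal_re, Complex.sin_ofReal_re]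
  rw [this]; fun_prop

theorem unitVec_eq_exp (φ : ℝ) : unitVec φ = Complex.exp (φ * Complex.I) := by
  apply Complex.ext <;> simp [unitVec, Complex.exp_ofReal_mul_I_re, Complex.exp_ofReal_mul_I_im]

theorem unitVec_add (φ ψ : ℝ) : unitVec (φ + ψ) = unitVec φ * unitVec ψ := by
  simp only [unitVec_eq_exp, ← Complex.exp_add]; push_cast; ring_nf

@[simp] theorem norm_unitVec (φ : ℝ) : ‖unitVec φ‖ = 1 := by
  rw [unitVec_eq_exp, Complex.norm_exp_ofReal_mul_I]

theorem conj_unitVec (φ : ℝ) : (starRingEnd ℂ) (unitVec φ) = unitVec (-φ) := by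
  apply Complex.ext <;> simp [unitVec]

theorem unitVec_add_pi (φ : ℝ) : unitVec (φ + Real.pi) = -unitVec φ := by
  apply Complex.ext <;> simp [unitVec]

theorem unitVec_periodic : Function.Periodic unitVec (2 * Real.pi) := fun φ => by
  apply Complex.ext <;> simp [unitVec]

theorem not_disjoint_link_blockage {x c : ℂ} {ℓ θ : ℝ} :
    ¬ Disjoint (link x) (blockage c ℓ θ) ↔ ∃ s ∈ Set.Icc (0 : ℝ) 1, ∃ t ∈ Set.Icc (0 : ℝ) 1,
      (s : ℂ) * x = c + (((2 * t - 1) * (ℓ / 2) : ℝ) : ℂ) * unitVec θ := by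
  have h : ∀ t : ℝ, (c - ((ℓ / 2 : ℝ) : ℂ) * unitVec θ) +
      t • ((c + ((ℓ / 2 : ℝ) : ℂ) * unitVec θ) - (c - ((ℓ / 2 : ℝ) : ℂ) * unitVec θ)) =
      c + (((2 * t - 1) * (ℓ / 2) : ℝ) : ℂ) * unitVec θ := fun t => by
    rw [Complex.real_smul]; push_cast; ring
  rw [Set.not_disjoint_iff, link, blockage, segment_eq_image', segment_eq_image']
  constructor
  · rintro ⟨_, ⟨s, hs, rfl⟩, ⟨t, ht, h'⟩⟩
    refine ⟨s, hs, t, ht, ?_⟩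
    rw [← h]
    exact Eq.symm (h'.trans (by simp))
  · rintro ⟨s, hs, t, ht, h'⟩
    refine ⟨_, ⟨s, hs, rfl⟩, ⟨t, ht, ?_⟩⟩
    beta_reduce
    rw [h, ← h']
    simp

/-- Meeting is an equation in two parameters from `[0, 1]`; projecting a closed set along a compact
factor keeps it closed. All measurability of LOS events and of parallelograms rests on this. -/
theorem isClosed_setOf_not_disjoint_link_blockage :
    IsClosed {q : ℂ × ℂ × ℝ × ℝ | ¬ Disjoint (link q.1) (blockage q.2.1 q.2.2.1 q.2.2.2)} := by
  have hc : IsClosed {p : (Set.Icc (0 : ℝ) 1 × Set.Icc (0 : ℝ) 1) × (ℂ × ℂ × ℝ × ℝ) |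
      ((p.1.1 : ℝ) : ℂ) * p.2.1 = p.2.2.1 +
        (((2 * (p.1.2 : ℝ) - 1) * (p.2.2.2.1 / 2) : ℝ) : ℂ) * unitVec p.2.2.2.2} := by
    refine isClosed_eq (by fun_prop) ?_
    have := continuous_unitVec
    fun_prop
  convert isClosedMap_snd_of_compactSpace _ hc using 1
  ext q
  simp only [Set.mem_ofPred_eq, Set.mem_image, not_disjoint_link_blockage]
  constructor
  · rintro ⟨s, hs, t, ht, h⟩
    exact ⟨⟨⟨⟨s, hs⟩, ⟨t, ht⟩⟩, q⟩, h, rfl⟩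
  · rintro ⟨⟨⟨s, t⟩, q'⟩, h, rfl⟩
    exact ⟨s, s.2, t, t.2, h⟩

/-- Solving the meeting equation for the center gives a point of the link minus a point of the
centered blockage, and the latter is symmetric about the origin. The condition on `ℓ` is needed
because for `ℓ < 0` the parallelogram is empty while the blockage is still a segment. -/
theorem mem_parallelogram_iff {r φ ℓ θ : ℝ} {c : ℂ} :
    c ∈ parallelogram r φ ℓ θ ↔
      0 ≤ ℓ ∧ ¬ Disjoint (link ((r : ℂ) * unitVec φ)) (blockage c ℓ θ) := by
  rw [not_disjoint_link_blockage]
  constructor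
  · rintro ⟨s, hs, t, ht, rfl⟩
    have hℓ : 0 ≤ ℓ := by linarith [ht.1, ht.2]
    refine ⟨hℓ, s, hs, ?_⟩
    -- The parameter `1 / 2 - t / ℓ` requires `ℓ ≠ 0`; a blockage of length zero is a point, reached
    -- with any parameter.
    rcases hℓ.eq_or_lt with rfl | hpos
    · have : t = 0 := by simpa using ht
      exact ⟨0, by simp, by subst this; simp [mul_assoc]⟩
    · refine ⟨1 / 2 - t / ℓ, ⟨?_, ?_⟩, ?_⟩
      · have : t / ℓ ≤ 1 / 2 := by rw [div_le_iff₀ hpos]; linarith [ht.2]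
        linarith
      · have : -(1 / 2) ≤ t / ℓ := by rw [le_div_iff₀ hpos]; linarith [ht.1]
        linarith
      · have : (2 * (1 / 2 - t / ℓ) - 1) * (ℓ / 2) = -t := by field_simp; ring
        rw [this]; push_cast; ring
  · rintro ⟨hℓ, s, hs, t, ht, h⟩
    refine ⟨s, hs, -((2 * t - 1) * (ℓ / 2)), ⟨?_, ?_⟩, ?_⟩
    · nlinarith [ht.1, ht.2]
    · nlinarith [ht.1, ht.2]
    · have : c = (s : ℂ) * (r * unitVec φ) -
          (((2 * t - 1) * (ℓ / 2) : ℝ) : ℂ) * unitVec θ := by rw [h]; ring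
      rw [this]; push_cast; ring

theorem measurableSet_setOf_mem_parallelogram :
    MeasurableSet {q : (ℝ × ℝ × ℝ × ℝ) × ℂ |
      q.2 ∈ parallelogram q.1.1 q.1.2.1 q.1.2.2.1 q.1.2.2.2} := by
  simp only [mem_parallelogram_iff]
  have hm := isClosed_setOf_not_disjoint_link_blockage.measurableSet
  have hu := continuous_unitVec.measurable
  have hf : Measurable fun q : (ℝ × ℝ × ℝ × ℝ) × ℂ =>
      (((q.1.1 : ℂ) * unitVec q.1.2.1, q.2, q.1.2.2.1, q.1.2.2.2) : ℂ × ℂ × ℝ × ℝ) := by fun_prop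
  exact (measurableSet_le measurable_const (by fun_prop :
    Measurable fun q : (ℝ × ℝ × ℝ × ℝ) × ℂ => q.1.2.2.1)).inter (hf hm)

/-- The parallelogram lies in the linear image of a rectangle of area `ℓ`, with determinant `r sin(θ
- φ)`. The bound is linear in `ℓ`, which is why a finite mean length suffices for integrability. -/
theorem volume_parallelogram_le (r φ ℓ θ : ℝ) :
    (volume : Measure ℂ) (parallelogram r φ ℓ θ) ≤ ENNReal.ofReal (|r| * ℓ) := by
  set T : ℂ →ₗ[ℝ] ℂ := Matrix.toLin Complex.basisOneI Complex.basisOneI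
    !![r * Real.cos φ, Real.cos θ; r * Real.sin φ, Real.sin θ] with hT
  have hTz : ∀ z : ℂ, T z = ((z.re * r : ℝ) : ℂ) * unitVec φ + ((z.im : ℝ) : ℂ) * unitVec θ := by
    intro z
    rw [hT, Matrix.toLin_apply]
    apply Complex.ext <;> simp [Fin.sum_univ_two, Matrix.mulVec, dotProduct, unitVec,
      Complex.cos_ofReal_re, Complex.sin_ofReal_re] <;> ring
  have hdet : LinearMap.det T = r * Real.sin (θ - φ) := by
    rw [hT, LinearMap.det_toLin, Matrix.det_fin_two_of, Real.sin_sub]; ring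
  have him : parallelogram r φ ℓ θ ⊆
      T '' (Set.Icc (0 : ℝ) 1 ×ℂ Set.Icc (-(ℓ / 2)) (ℓ / 2)) := by
    rintro _ ⟨s, hs, t, ht, rfl⟩
    exact ⟨⟨s, t⟩, ⟨hs, ht⟩, hTz _⟩
  have hbox : (volume : Measure ℂ) (Set.Icc (0 : ℝ) 1 ×ℂ Set.Icc (-(ℓ / 2)) (ℓ / 2)) =
      ENNReal.ofReal ℓ := by
    have := Complex.volume_preserving_equiv_real_prod.measure_preimage
      (s := Set.Icc (0 : ℝ) 1 ×ˢ Set.Icc (-(ℓ / 2)) (ℓ / 2))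
      (measurableSet_Icc.prod measurableSet_Icc).nullMeasurableSet
    rw [Measure.volume_eq_prod, Measure.prod_prod, Real.volume_Icc, Real.volume_Icc] at this
    refine Eq.trans (congrArg volume ?_) (this.trans ?_)
    · rfl
    rw [sub_zero, ENNReal.ofReal_one, one_mul]
    congr 1; ring
  refine (measure_mono him).trans ?_
  rw [Measure.addHaar_image_linearMap, hbox, hdet, abs_mul, ← ENNReal.ofReal_mul (by positivity)]
  rcases le_or_gt ℓ 0 with hℓ | hℓ
  · rw [ENNReal.ofReal_of_nonpos (mul_nonpos_of_nonneg_of_nonpos (by positivity) hℓ)]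
    exact zero_le
  · gcongr
    exact mul_le_of_le_one_right (abs_nonneg _) (Real.abs_sin_le_one _)

/-! ### Measurability and mean of the union area -/

section UnionArea

variable {n : ℕ} (S : Finset (Fin n))

theorem measurableSet_setOf_mem_iUnion_parallelogram :
    MeasurableSet {q : (((Fin n → ℝ) × (Fin n → ℝ)) × ℝ × ℝ) × ℂ |
      q.2 ∈ ⋃ i ∈ S, parallelogram (q.1.1.1 i) (q.1.1.2 i) q.1.2.1 q.1.2.2} := by
  have : {q : (((Fin n → ℝ) × (Fin n → ℝ)) × ℝ × ℝ) × ℂ |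
      q.2 ∈ ⋃ i ∈ S, parallelogram (q.1.1.1 i) (q.1.1.2 i) q.1.2.1 q.1.2.2} =
      ⋃ i ∈ S, (fun q : (((Fin n → ℝ) × (Fin n → ℝ)) × ℝ × ℝ) × ℂ =>
        ((q.1.1.1 i, q.1.1.2 i, q.1.2.1, q.1.2.2), q.2)) ⁻¹'
        {q : (ℝ × ℝ × ℝ × ℝ) × ℂ | q.2 ∈ parallelogram q.1.1 q.1.2.1 q.1.2.2.1 q.1.2.2.2} := by
    ext q; simp
  rw [this]
  exact S.measurableSet_biUnion fun i _ =>
    measurableSet_setOf_mem_parallelogram.preimage (by fun_prop)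

theorem measurable_volume_iUnion_parallelogram :
    Measurable fun q : ((Fin n → ℝ) × (Fin n → ℝ)) × ℝ × ℝ =>
      (volume : Measure ℂ) (⋃ i ∈ S, parallelogram (q.1.1 i) (q.1.2 i) q.2.1 q.2.2) :=
  measurable_measure_prodMk_left (measurableSet_setOf_mem_iUnion_parallelogram S)

theorem measurable_volume_iUnion_parallelogram_right (r φ : Fin n → ℝ) :
    Measurable fun p : ℝ × ℝ =>
      (volume : Measure ℂ) (⋃ i ∈ S, parallelogram (r i) (φ i) p.1 p.2) := by
  exact Measurable.of_uncurry_left (f := fun (a : (Fin n → ℝ) × (Fin n → ℝ)) (p : ℝ × ℝ) =>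
    (volume : Measure ℂ) (⋃ i ∈ S, parallelogram (a.1 i) (a.2 i) p.1 p.2))
    (measurable_volume_iUnion_parallelogram S) (x := (r, φ))

theorem volume_iUnion_parallelogram_le (r φ : Fin n → ℝ) (ℓ θ : ℝ) :
    (volume : Measure ℂ) (⋃ i ∈ S, parallelogram (r i) (φ i) ℓ θ) ≤
      ENNReal.ofReal (∑ i ∈ S, |r i|) * ENNReal.ofReal ℓ := by
  refine (measure_biUnion_finset_le _ _).trans ?_
  rw [ENNReal.ofReal_sum_of_nonneg fun _ _ => abs_nonneg _, Finset.sum_mul]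
  refine Finset.sum_le_sum fun i _ => (volume_parallelogram_le _ _ _ _).trans ?_
  rw [ENNReal.ofReal_mul (abs_nonneg _)]

variable {FL FT : Measure ℝ} [IsProbabilityMeasure FL] [IsProbabilityMeasure FT]

theorem lintegral_volume_iUnion_parallelogram_ne_top (hmean : Integrable (fun ℓ : ℝ => ℓ) FL)
    (r φ : Fin n → ℝ) :
    ∫⁻ p, (volume : Measure ℂ) (⋃ i ∈ S, parallelogram (r i) (φ i) p.1 p.2) ∂(FL.prod FT)
      ≠ ∞ := by
  refine ne_top_of_le_ne_top ?_ (lintegral_mono fun p =>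
    volume_iUnion_parallelogram_le S r φ p.1 p.2)
  rw [lintegral_const_mul _ (by fun_prop)]
  refine ENNReal.mul_ne_top ENNReal.ofReal_ne_top ?_
  have h := (measurePreserving_fst (μ := FL) (ν := FT)).lintegral_comp
    (f := fun ℓ => ENNReal.ofReal ℓ) (by fun_prop)
  rw [h]
  exact (hmean.lintegral_lt_top).ne

theorem integrable_unionArea (hmean : Integrable (fun ℓ : ℝ => ℓ) FL) (r φ : Fin n → ℝ) :
    Integrable (fun p : ℝ × ℝ => unionArea S r φ p.1 p.2) (FL.prod FT) := by
  simp only [unionArea, Measure.real]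
  exact integrable_toReal_of_lintegral_ne_top
    (measurable_volume_iUnion_parallelogram_right S r φ).aemeasurable
    (lintegral_volume_iUnion_parallelogram_ne_top S hmean r φ)

/-- The domain of integration carries all the mass of `FL.prod FT`. The form with `∫⁻` is the one to
which Tonelli and the void probability apply. -/
theorem meanUnionArea_eq_toReal (hFL : ∀ᵐ ℓ ∂FL, 0 ≤ ℓ) (hFT : ∀ᵐ θ ∂FT, θ ∈ Set.Icc 0 Real.pi)
    (r φ : Fin n → ℝ) :
    meanUnionArea FL FT S r φ =
      (∫⁻ p, (volume : Measure ℂ) (⋃ i ∈ S, parallelogram (r i) (φ i) p.1 p.2)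
        ∂(FL.prod FT)).toReal := by
  have hae : ∀ᵐ p ∂(FL.prod FT), p ∈ Set.Ici (0 : ℝ) ×ˢ Set.Icc (0 : ℝ) Real.pi := by
    have h1 := (Measure.quasiMeasurePreserving_fst (μ := FL) (ν := FT)).ae hFL
    have h2 := (Measure.quasiMeasurePreserving_snd (μ := FL) (ν := FT)).ae hFT
    filter_upwards [h1, h2] with p hp1 hp2 using ⟨hp1, hp2⟩
  rw [meanUnionArea, Measure.restrict_eq_self_of_ae_mem hae]
  simp only [unionArea, Measure.real]
  refine integral_toReal (measurable_volume_iUnion_parallelogram_right S r φ).aemeasurable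
    (Filter.Eventually.of_forall fun p => ?_)
  exact (volume_iUnion_parallelogram_le S r φ p.1 p.2).trans_lt
    (ENNReal.mul_lt_top ENNReal.ofReal_lt_top ENNReal.ofReal_lt_top)

theorem measurable_meanUnionArea (hFL : ∀ᵐ ℓ ∂FL, 0 ≤ ℓ)
    (hFT : ∀ᵐ θ ∂FT, θ ∈ Set.Icc 0 Real.pi) :
    Measurable fun q : (Fin n → ℝ) × (Fin n → ℝ) => meanUnionArea FL FT S q.1 q.2 := by
  simp_rw [meanUnionArea_eq_toReal S hFL hFT]
  exact (measurable_volume_iUnion_parallelogram S).lintegral_prod_right'.ennreal_toReal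

end UnionArea

/-! ### Line-of-sight probabilities of fixed links -/

theorem measurableSet_setOf_isLOS :
    MeasurableSet {q : ℂ × (ℕ → ℂ × ℝ × ℝ) |
      IsLOS q.1 (fun k => (q.2 k).1) (fun k => (q.2 k).2.1) (fun k => (q.2 k).2.2)} := by
  simp only [IsLOS, Set.ofPred_forall]
  refine MeasurableSet.iInter fun k => ?_
  have h := isClosed_setOf_not_disjoint_link_blockage.measurableSet.compl
  have hf : Measurable fun q : ℂ × (ℕ → ℂ × ℝ × ℝ) =>
    ((q.1, (q.2 k).1, (q.2 k).2.1, (q.2 k).2.2) : ℂ × ℂ × ℝ × ℝ) := by fun_prop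
  convert hf h using 1
  ext q
  simp

namespace IsCellularNetwork

variable {Ω : Type*} [MeasurableSpace Ω] {P : Measure Ω} [IsProbabilityMeasure P]
  {lam mu : ℝ} {FL FT : Measure ℝ} [IsProbabilityMeasure FL] [IsProbabilityMeasure FT]
  {X C : ℕ → Ω → ℂ} {L T : ℕ → Ω → ℝ}

theorem measurable_blockages (hnet : IsCellularNetwork P lam mu FL FT X C L T) :
    Measurable fun ω (k : ℕ) => (C k ω, L k ω, T k ω) :=
  measurable_pi_lambda _ fun k => (hnet.centers.measurable k).prodMk
    ((hnet.measurable_length k).prodMk (hnet.measurable_orientation k))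

theorem measurableSet_isLOS (hnet : IsCellularNetwork P lam mu FL FT X C L T) (x : ℂ) :
    MeasurableSet {ω | IsLOS x (fun k => C k ω) (fun k => L k ω) (fun k => T k ω)} :=
  measurableSet_setOf_isLOS.preimage (measurable_const.prodMk hnet.measurable_blockages)

/-- The probability that all the links in a given set are line-of-sight. -/
theorem measureReal_iInter_isLOS (hnet : IsCellularNetwork P lam mu FL FT X C L T) (hmu : 0 < mu)
    (hFL : ∀ᵐ ℓ ∂FL, 0 ≤ ℓ) (hmean : Integrable (fun ℓ : ℝ => ℓ) FL)
    (hFT : ∀ᵐ θ ∂FT, θ ∈ Set.Icc 0 Real.pi) {n : ℕ} (S : Finset (Fin n)) (r φ : Fin n → ℝ) :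
    P.real (⋂ i ∈ S, {ω | IsLOS ((r i : ℂ) * unitVec (φ i))
      (fun k => C k ω) (fun k => L k ω) (fun k => T k ω)}) =
      Real.exp (-(mu * meanUnionArea FL FT S r φ)) := by
  set D : Set (ℂ × ℝ × ℝ) := ⋃ i ∈ S, {q | ¬ Disjoint (link ((r i : ℂ) * unitVec (φ i)))
    (blockage q.1 q.2.1 q.2.2)} with hDdef
  have hD : MeasurableSet D := S.measurableSet_biUnion fun i _ =>
    isClosed_setOf_not_disjoint_link_blockage.measurableSet.preimage
      (measurable_const.prodMk measurable_id)
  have hval : ((ENNReal.ofReal mu • (volume : Measure ℂ)).prod (FL.prod FT)) D =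
      ENNReal.ofReal mu * ∫⁻ p, (volume : Measure ℂ)
        (⋃ i ∈ S, parallelogram (r i) (φ i) p.1 p.2) ∂(FL.prod FT) := by
    -- The section of `D` at a mark `(ℓ, θ)` is the union of the parallelograms. This holds for `ℓ ≥
    -- 0`, hence almost everywhere.
    rw [Measure.prod_apply_symm hD, ← lintegral_const_mul']
    · refine lintegral_congr_ae ?_
      filter_upwards [(Measure.quasiMeasurePreserving_fst (μ := FL) (ν := FT)).ae hFL] with p hp
      rw [Measure.smul_apply, smul_eq_mul]
      congr 2
      ext c
      simp only [hDdef, Set.mem_preimage, Set.mem_iUnion, Set.mem_ofPred_eq,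
        mem_parallelogram_iff, hp, true_and]
    · exact ENNReal.ofReal_ne_top
  have hI := lintegral_volume_iUnion_parallelogram_ne_top (FT := FT) S hmean r φ
  have hset : (⋂ i ∈ S, {ω | IsLOS ((r i : ℂ) * unitVec (φ i))
      (fun k => C k ω) (fun k => L k ω) (fun k => T k ω)}) =
      {ω | ∀ k, (C k ω, (L k ω, T k ω)) ∉ D} := by
    ext ω
    simp only [hDdef, IsLOS, Set.mem_iInter, Set.mem_ofPred_eq, Set.mem_iUnion, not_exists, not_not]
    exact ⟨fun h k i hi => h i hi k, fun h i hi k => h k i hi⟩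
  rw [hset, Measure.real, hnet.centers.measure_forall_notMem_marked
    (fun k => (hnet.measurable_length k).prodMk (hnet.measurable_orientation k))
    hnet.marks_law hnet.marks_indep hnet.centers_indep_marks hD
    (hval ▸ ENNReal.mul_ne_top ENNReal.ofReal_ne_top hI), hval,
    ENNReal.toReal_ofReal (Real.exp_pos _).le, ENNReal.toReal_mul, ENNReal.toReal_ofReal hmu.le,
    meanUnionArea_eq_toReal S hFL hFT]

/-- The probability that at least one of several fixed links is line-of-sight. -/
theorem measureReal_iUnion_isLOS (hnet : IsCellularNetwork P lam mu FL FT X C L T) (hmu : 0 < mu)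
    (hFL : ∀ᵐ ℓ ∂FL, 0 ≤ ℓ) (hmean : Integrable (fun ℓ : ℝ => ℓ) FL)
    (hFT : ∀ᵐ θ ∂FT, θ ∈ Set.Icc 0 Real.pi) {n : ℕ} (r φ : Fin n → ℝ) :
    P.real (⋃ i, {ω | IsLOS ((r i : ℂ) * unitVec (φ i))
      (fun k => C k ω) (fun k => L k ω) (fun k => T k ω)}) = inclExclSum mu FL FT r φ := by
  have h := measureReal_biUnion_eq_sum_powerset (μ := P) (t := (Finset.univ : Finset (Fin n)))
    (s := fun i => {ω | IsLOS ((r i : ℂ) * unitVec (φ i))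
      (fun k => C k ω) (fun k => L k ω) (fun k => T k ω)})
    (fun i _ => hnet.measurableSet_isLOS _)
  simp only [Finset.mem_univ, Set.iUnion_true] at h
  rw [h, inclExclSum]
  refine Finset.sum_congr rfl fun S hS => ?_
  rw [hnet.measureReal_iInter_isLOS hmu hFL hmean hFT]
  -- The general inclusion-exclusion formula has the exponent `S.card + 1`; it has the parity of
  -- `S.card - 1` because `S` is nonempty.
  obtain ⟨m, hm⟩ := Nat.exists_eq_succ_of_ne_zero
    (Finset.card_pos.2 (Finset.mem_filter.1 hS).2).ne'
  rw [hm, Nat.succ_sub_one, Nat.succ_eq_add_one, add_assoc, pow_add]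
  norm_num

/-- If the stations `Y` are independent of the blockages, then the reliability is the mean
probability that one of the links is line-of-sight when the stations are frozen. -/
theorem reliability_eq_toReal_lintegral (hnet : IsCellularNetwork P lam mu FL FT X C L T) {n : ℕ}
    {Y : ℕ → Ω → ℂ} (hY : Measurable fun ω (i : ℕ) => Y i ω)
    (hind : IndepFun (fun ω (i : ℕ) => Y i ω) (fun ω (k : ℕ) => (C k ω, L k ω, T k ω)) P) :
    reliability P n Y C L T = (∫⁻ ω, P (⋃ i : Fin n, {ω' | IsLOS (Y i ω)
      (fun k => C k ω') (fun k => L k ω') (fun k => T k ω')}) ∂P).toReal := by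
  have hB := hnet.measurable_blockages
  have hW : MeasurableSet (⋃ i : Fin n, (fun q : (ℕ → ℂ) × (ℕ → ℂ × ℝ × ℝ) => (q.1 i, q.2)) ⁻¹'
      {q : ℂ × (ℕ → ℂ × ℝ × ℝ) |
        IsLOS q.1 (fun k => (q.2 k).1) (fun k => (q.2 k).2.1) (fun k => (q.2 k).2.2)}) :=
    MeasurableSet.iUnion fun i => measurableSet_setOf_isLOS.preimage (by fun_prop)
  have : IsProbabilityMeasure (P.map fun ω (k : ℕ) => (C k ω, L k ω, T k ω)) :=
    Measure.isProbabilityMeasure_map hB.aemeasurable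
  have h1 := (indepFun_iff_map_prod_eq_prod_map_map hY.aemeasurable hB.aemeasurable).1 hind
  have h2 := congrArg (fun μ => μ (⋃ i : Fin n,
    (fun q : (ℕ → ℂ) × (ℕ → ℂ × ℝ × ℝ) => (q.1 i, q.2)) ⁻¹'
      {q : ℂ × (ℕ → ℂ × ℝ × ℝ) |
        IsLOS q.1 (fun k => (q.2 k).1) (fun k => (q.2 k).2.1) (fun k => (q.2 k).2.2)})) h1
  beta_reduce at h2
  rw [Measure.map_apply (hY.prodMk hB) hW, Measure.prod_apply hW,
    lintegral_map (measurable_measure_prodMk_left hW) hY] at h2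
  rw [reliability, Measure.real]
  congr 1
  refine Eq.trans (congrArg P ?_) (h2.trans (lintegral_congr fun ω => ?_))
  · simp only [Set.preimage_iUnion]; rfl
  · rw [Measure.map_apply hB (measurable_prodMk_left hW)]
    refine congrArg P ?_
    simp only [Set.preimage_iUnion]; rfl

end IsCellularNetwork

/-! ### Law of the nearest stations: the local lower bound -/

/-- Making the cover disjoint turns the local inequalities into a termwise comparison of two series.
Only `ρ` has to be concentrated on the cover. -/
theorem MeasureTheory.Measure.le_of_forall_subset_countable_cover {α ι : Type*}
    [MeasurableSpace α] [Countable ι] {ρ μ : Measure α} {V : ι → Set α}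
    (hV : ∀ i, MeasurableSet (V i))
    (h : ∀ i B, MeasurableSet B → B ⊆ V i → ρ B ≤ μ B) (hc : ρ (⋃ i, V i)ᶜ = 0) : ρ ≤ μ := by
  refine Measure.le_iff.2 fun B hB => ?_
  rcases isEmpty_or_nonempty ι with hι | hι
  · rw [Set.iUnion_of_empty, Set.compl_empty] at hc
    exact (measure_mono_null (Set.subset_univ B) hc).le.trans bot_le
  obtain ⟨f, hf⟩ := exists_surjective_nat ι
  have hW : ∀ k, MeasurableSet (disjointed (V ∘ f) k) :=
    fun k => MeasurableSet.disjointed (fun k => hV (f k)) k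
  have hU : ⋃ k, disjointed (V ∘ f) k = ⋃ i, V i := by
    rw [iUnion_disjointed]; exact hf.iUnion_comp V
  have hd : Pairwise (Function.onFun Disjoint fun k => B ∩ disjointed (V ∘ f) k) :=
    fun i j hij => (disjoint_disjointed (V ∘ f) hij).mono Set.inter_subset_right
      Set.inter_subset_right
  calc ρ B ≤ ρ (B ∩ ⋃ i, V i) + ρ (⋃ i, V i)ᶜ := by
        refine (measure_mono ?_).trans (measure_union_le _ _)
        intro x hx
        by_cases hxV : x ∈ ⋃ i, V i
        exacts [Or.inl ⟨hx, hxV⟩, Or.inr hxV]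
    _ = ∑' k, ρ (B ∩ disjointed (V ∘ f) k) := by
        rw [hc, add_zero, ← hU, Set.inter_iUnion, measure_iUnion hd fun k => hB.inter (hW k)]
    _ ≤ ∑' k, μ (B ∩ disjointed (V ∘ f) k) :=
        ENNReal.tsum_le_tsum fun k => h (f k) _ (hB.inter (hW k))
          (Set.inter_subset_right.trans (disjointed_subset _ _))
    _ = μ (B ∩ ⋃ i, V i) := by
        rw [← hU, Set.inter_iUnion, measure_iUnion hd fun k => hB.inter (hW k)]
    _ ≤ μ B := measure_mono Set.inter_subset_left

/-- For points listed by increasing norm: the first `n` points lie in radially ordered sets and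
are the only ones in the ball of radius `b` iff each of these sets contains exactly one point and
there is no other point in the ball. -/
theorem forall_mem_and_ball_iff_encard {x : ℕ → ℂ} (hx : Monotone fun j => ‖x j‖) {n : ℕ}
    {A : Fin n → Set ℂ} {b : ℝ} (hA : ∀ i j, i < j → ∀ z ∈ A i, ∀ w ∈ A j, ‖z‖ < ‖w‖)
    (hb : ∀ i, A i ⊆ Metric.closedBall 0 b) :
    ((∀ i : Fin n, x i ∈ A i) ∧ ∀ j, ‖x j‖ ≤ b ↔ j < n) ↔
      (∀ i, {j | x j ∈ A i}.encard = 1) ∧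
        {j | x j ∈ Metric.closedBall 0 b \ ⋃ i, A i}.encard = 0 := by
  have hball : ∀ i z, z ∈ A i → ‖z‖ ≤ b := fun i z hz => by simpa using hb i hz
  constructor
  · rintro ⟨h1, h2⟩
    constructor
    · intro i
      rw [Set.encard_eq_one]
      refine ⟨i, Set.eq_singleton_iff_unique_mem.2 ⟨h1 i, fun j hj => ?_⟩⟩
      have hjn : j < n := (h2 j).1 (hball i _ hj)
      have hj' := h1 ⟨j, hjn⟩
      rcases lt_trichotomy i ⟨j, hjn⟩ with h | h | h
      · exact absurd (hA _ _ h _ hj _ hj') (lt_irrefl _)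
      · rw [h]
      · exact absurd (hA _ _ h _ hj' _ hj) (lt_irrefl _)
    · rw [Set.encard_eq_zero, Set.eq_empty_iff_forall_notMem]
      rintro j ⟨hj1, hj2⟩
      have hjn : j < n := (h2 j).1 (by simpa using hj1)
      exact hj2 (Set.mem_iUnion.2 ⟨⟨j, hjn⟩, h1 ⟨j, hjn⟩⟩)
  · rintro ⟨h1, h2⟩
    rw [Set.encard_eq_zero, Set.eq_empty_iff_forall_notMem] at h2
    simp only [Set.encard_eq_one] at h1
    choose k hk using h1
    have hkA : ∀ i, x (k i) ∈ A i := fun i => by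
      have : k i ∈ {j | x j ∈ A i} := by rw [hk i]; rfl
      exact this
    have hkmono : StrictMono k := fun i j hij => by
      by_contra hle
      exact absurd (hA i j hij _ (hkA i) _ (hkA j)) (not_lt.2 (hx (not_lt.1 hle)))
    have hrange : ∀ j, ‖x j‖ ≤ b → ∃ i, k i = j := fun j hj => by
      have : x j ∈ ⋃ i, A i := by
        by_contra hn
        exact h2 j ⟨by simpa using hj, hn⟩
      obtain ⟨i, hi⟩ := Set.mem_iUnion.1 this
      have hj' : j ∈ {j | x j ∈ A i} := hi
      rw [hk i] at hj'
      exact ⟨i, hj'.symm⟩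
    -- The indices of points in the ball form an initial segment, since norms increase along the
    -- list. All of them are in the range of the strictly increasing `k`, which must therefore be
    -- the identity.
    have hkid : ∀ m (hm : m < n), k ⟨m, hm⟩ = m := by
      intro m
      induction m using Nat.strong_induction_on with
      | _ m ih =>
        intro hm
        have hle : m ≤ k ⟨m, hm⟩ := by
          by_contra! hlt
          have := ih _ hlt (hlt.trans hm)
          exact absurd (hkmono.injective this) (fun h => hlt.ne (congrArg Fin.val h))
        obtain ⟨i, hi⟩ := hrange m ((hx hle).trans (hball _ _ (hkA _)))
        rcases lt_trichotomy i ⟨m, hm⟩ with h | h | h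
        · have h' : (i : ℕ) < m := h
          have := ih i h' i.2
          rw [Fin.eta, hi] at this
          exact absurd this h'.ne'
        · rw [← h, hi]
        · have := hkmono h
          omega
    refine ⟨fun i => ?_, fun j => ⟨fun hj => ?_, fun hj => ?_⟩⟩
    · have := hkA i
      rwa [hkid i i.2] at this
    · obtain ⟨i, rfl⟩ := hrange j hj
      rw [hkid i i.2]
      exact i.2
    · have := hball _ _ (hkA ⟨j, hj⟩)
      rwa [hkid j hj] at this

namespace IsPoissonProcess

variable {Ω : Type*} [MeasurableSpace Ω] {P : Measure Ω} {X : ℕ → Ω → ℂ} {lam : ℝ}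

/-- Almost surely the event says that each `A i` holds one point and the rest of the ball none. The
independent Poisson counts contribute `λ |A i|` per set, and their exponential factors combine to
that of the whole ball, whatever the sets are. -/
theorem measure_forall_mem_and_ball
    (hX : IsPoissonProcess P (ENNReal.ofReal lam • (volume : Measure ℂ)) X) (hlam : 0 < lam)
    (hord : ∀ᵐ ω ∂P, Monotone fun i => ‖X i ω‖) {n : ℕ}
    {A : Fin n → Set ℂ} {b : ℝ} (hb0 : 0 ≤ b) (hAm : ∀ i, MeasurableSet (A i))
    (hA : ∀ i j, i < j → ∀ z ∈ A i, ∀ w ∈ A j, ‖z‖ < ‖w‖)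
    (hb : ∀ i, A i ⊆ Metric.closedBall 0 b) :
    P {ω | (∀ i : Fin n, X i ω ∈ A i) ∧ ∀ j, ‖X j ω‖ ≤ b ↔ j < n} =
      ENNReal.ofReal (lam ^ n * Real.exp (-(lam * Real.pi * b ^ 2))) *
        ∏ i, (volume : Measure ℂ) (A i) := by
  classical
  set ν := ENNReal.ofReal lam • (volume : Measure ℂ) with hν
  set Z := Metric.closedBall (0 : ℂ) b \ ⋃ i, A i with hZ
  have hd : Pairwise fun i j => Disjoint (A i) (A j) := by
    intro i j hij
    refine Set.disjoint_left.2 fun z hi hj => ?_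
    rcases lt_or_gt_of_ne hij with h | h
    · exact absurd (hA _ _ h z hi z hj) (lt_irrefl _)
    · exact absurd (hA _ _ h z hj z hi) (lt_irrefl _)
  have hball : ν (Metric.closedBall (0 : ℂ) b) = ENNReal.ofReal (lam * Real.pi * b ^ 2) := by
    rw [hν, Measure.smul_apply, Complex.volume_closedBall, smul_eq_mul, mul_assoc lam,
      ENNReal.ofReal_mul hlam.le, mul_comm Real.pi, ENNReal.ofReal_mul (sq_nonneg b),
      ENNReal.ofReal_pow hb0, ENNReal.ofReal_eq_coe_nnreal Real.pi_pos.le]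
    rfl
  have hballfin : ν (Metric.closedBall (0 : ℂ) b) ≠ ∞ := hball ▸ ENNReal.ofReal_ne_top
  have hAfin : ∀ i, ν (A i) ≠ ∞ := fun i => ne_top_of_le_ne_top hballfin (measure_mono (hb i))
  have hZfin : ν Z ≠ ∞ := ne_top_of_le_ne_top hballfin (measure_mono Set.sdiff_subset)
  have hsum : (ν Z).toReal + ∑ i, (ν (A i)).toReal = lam * Real.pi * b ^ 2 := by
    have h1 : ν (⋃ i, A i) = ∑ i, ν (A i) := by rw [measure_iUnion hd hAm, tsum_fintype]
    have h2 : ν (Metric.closedBall (0 : ℂ) b) = ν Z + ν (⋃ i, A i) := by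
      rw [← measure_union Set.disjoint_sdiff_left (MeasurableSet.iUnion hAm),
        Set.sdiff_union_of_subset (Set.iUnion_subset hb)]
    rw [← ENNReal.toReal_sum fun i _ => hAfin i, ← h1, ← ENNReal.toReal_add hZfin
      (h1 ▸ ENNReal.sum_ne_top.2 fun i _ => hAfin i), ← h2, hball,
      ENNReal.toReal_ofReal (by positivity)]
  -- The index `none` stands for the rest of the ball, where the prescribed count is 0.
  let B : Option (Fin n) → Set ℂ := fun o => o.elim Z A
  have hlaw := hX.law_fintype (B := B) (fun o => by
      cases o with
      | none => exact Metric.isClosed_closedBall.measurableSet.diff (MeasurableSet.iUnion hAm)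
      | some i => exact hAm i)
    (by
      rintro (_ | i) (_ | j) hij
      · exact absurd rfl hij
      · exact Set.disjoint_left.2 fun z hz hz' => hz.2 (Set.mem_iUnion.2 ⟨j, hz'⟩)
      · exact Set.disjoint_left.2 fun z hz hz' => hz'.2 (Set.mem_iUnion.2 ⟨i, hz⟩)
      · exact hd fun h => hij (congrArg some h))
    (fun o => by
      cases o with
      | none => exact hZfin.lt_top
      | some i => exact (hAfin i).lt_top) (fun o => o.elim 0 fun _ => 1)
  have hset : P {ω | (∀ i : Fin n, X i ω ∈ A i) ∧ ∀ j, ‖X j ω‖ ≤ b ↔ j < n} =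
      P {ω | ∀ o, {j | X j ω ∈ B o}.encard =
        ((o.elim 0 fun _ => 1 : ℕ) : ℕ∞)} := by
    refine measure_congr ?_
    filter_upwards [hord] with ω hω
    refine propext ((forall_mem_and_ball_iff_encard hω hA hb).trans ?_)
    constructor
    · rintro ⟨h1, h2⟩ (_ | i)
      · simpa only [B, Option.elim_none, Nat.cast_zero] using h2
      · simpa [B] using h1 i
    · intro h
      exact ⟨fun i => by simpa [B] using h (some i), by
        simpa only [B, Option.elim_none, Nat.cast_zero] using h none⟩
  rw [hset, hlaw, Fintype.prod_option]
  simp only [B, Option.elim_none, Option.elim_some, poissonMeasure_singleton, pow_zero, pow_one,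
    Nat.factorial_zero, Nat.factorial_one, Nat.cast_one, div_one, mul_one]
  have hvol : ∀ i, ENNReal.ofReal (Real.exp (-((ν (A i)).toNNReal : ℝ)) * (ν (A i)).toNNReal) =
      ENNReal.ofReal (Real.exp (-(ν (A i)).toReal)) * (ENNReal.ofReal lam * volume (A i)) := by
    intro i
    rw [ENNReal.ofReal_mul (Real.exp_pos _).le]
    congr 1
    change ENNReal.ofReal (ν (A i)).toReal = _
    rw [ENNReal.ofReal_toReal (hAfin i)]
    rfl
  simp_rw [hvol]
  rw [Finset.prod_mul_distrib, Finset.prod_mul_distrib, Finset.prod_const, Finset.card_univ,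
    Fintype.card_fin, ← ENNReal.ofReal_prod_of_nonneg fun _ _ => (Real.exp_pos _).le,
    ← Real.exp_sum, ← mul_assoc, ← mul_assoc, ← ENNReal.ofReal_mul (Real.exp_pos _).le]
  change ENNReal.ofReal (Real.exp (-(ν Z).toReal) * _) * _ * _ = _
  rw [← Real.exp_add, Finset.sum_neg_distrib, ← neg_add, hsum,
    ENNReal.ofReal_mul (pow_nonneg hlam.le n), ENNReal.ofReal_pow hlam.le,
    mul_comm (ENNReal.ofReal (Real.exp _))]

end IsPoissonProcess

open Classical in
/-- The joint density with respect to area, as a function of the distances, of the `n` points of a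
planar Poisson process that are nearest to the origin. -/
noncomputable def nearestPointsDensity (lam : ℝ) {n : ℕ} (hn : 0 < n) (s : Fin n → ℝ) : ℝ≥0∞ :=
  if StrictMono s then
    ENNReal.ofReal (lam ^ n *
      Real.exp (-(lam * Real.pi * s ⟨n - 1, Nat.sub_lt hn one_pos⟩ ^ 2)))
  else 0

theorem measurableSet_setOf_strictMono (n : ℕ) :
    MeasurableSet {s : Fin n → ℝ | StrictMono s} := by
  simp only [StrictMono, Set.ofPred_forall]
  exact MeasurableSet.iInter fun i => MeasurableSet.iInter fun j => MeasurableSet.iInter fun _ =>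
    measurableSet_lt (measurable_pi_apply i) (measurable_pi_apply j)

theorem measurable_nearestPointsDensity (lam : ℝ) {n : ℕ} (hn : 0 < n) :
    Measurable (nearestPointsDensity lam hn) := by
  classical
  unfold nearestPointsDensity
  exact Measurable.ite (measurableSet_setOf_strictMono n) (by fun_prop) measurable_const

namespace IsPoissonProcess

variable {Ω : Type*} [MeasurableSpace Ω] {P : Measure Ω} {X : ℕ → Ω → ℂ} {lam : ℝ}

/-- When exactly the first `n` points are in the ball, the law restricted to the box has the weights
of `c` times Lebesgue measure on product sets, hence equals it. Dropping that event leaves an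
inequality. -/
theorem ofReal_mul_volume_le_map
    (hX : IsPoissonProcess P (ENNReal.ofReal lam • (volume : Measure ℂ)) X) (hlam : 0 < lam)
    (hord : ∀ᵐ ω ∂P, Monotone fun i => ‖X i ω‖) {n : ℕ}
    {A : Fin n → Set ℂ} {b : ℝ} (hb0 : 0 ≤ b) (hAm : ∀ i, MeasurableSet (A i))
    (hA : ∀ i j, i < j → ∀ z ∈ A i, ∀ w ∈ A j, ‖z‖ < ‖w‖)
    (hb : ∀ i, A i ⊆ Metric.closedBall 0 b) {B : Set (Fin n → ℂ)} (hB : MeasurableSet B)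
    (hBA : B ⊆ Set.univ.pi A) :
    ENNReal.ofReal (lam ^ n * Real.exp (-(lam * Real.pi * b ^ 2))) * volume B ≤
      P.map (fun ω (i : Fin n) => X i ω) B := by
  have hXm := hX.measurable
  have hYm : Measurable fun ω (i : Fin n) => X i ω := measurable_pi_lambda _ fun i => hXm i
  set c := ENNReal.ofReal (lam ^ n * Real.exp (-(lam * Real.pi * b ^ 2)))
  have hc0 : c ≠ 0 := (ENNReal.ofReal_pos.2 (by positivity)).ne'
  have hct : c ≠ ∞ := ENNReal.ofReal_ne_top
  set G : Set Ω := {ω | ∀ j, ‖X j ω‖ ≤ b ↔ j < n} with hG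
  have hGm : MeasurableSet G := by
    rw [hG, Set.ofPred_forall]
    exact MeasurableSet.iInter fun j =>
      (measurableSet_le (hXm j).norm measurable_const).iff (MeasurableSet.const _)
  have hpi : Measure.pi (fun i => (volume : Measure ℂ).restrict (A i)) =
      c⁻¹ • (((P.restrict G).map fun ω (i : Fin n) => X i ω).restrict (Set.univ.pi A)) := by
    refine Measure.pi_eq fun s hs => ?_
    have hsm : MeasurableSet (Set.univ.pi s) := MeasurableSet.univ_pi hs
    have hAm' : MeasurableSet (Set.univ.pi A) := MeasurableSet.univ_pi hAm
    rw [Measure.smul_apply, Measure.restrict_apply hsm, Measure.map_apply hYm (hsm.inter hAm'),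
      Measure.restrict_apply (hYm (hsm.inter hAm'))]
    have h := hX.measure_forall_mem_and_ball hlam hord hb0 (fun i => (hs i).inter (hAm i))
      (fun i j hij z hz w hw => hA i j hij z hz.2 w hw.2)
      (fun i => Set.inter_subset_right.trans (hb i))
    have hset : (fun ω (i : Fin n) => X i ω) ⁻¹' (Set.univ.pi s ∩ Set.univ.pi A) ∩ G =
        {ω | (∀ i : Fin n, X i ω ∈ s i ∩ A i) ∧ ∀ j, ‖X j ω‖ ≤ b ↔ j < n} := by
      ext ω
      simp [hG, forall_and]
    rw [hset, h, smul_eq_mul, ← mul_assoc, ENNReal.inv_mul_cancel hc0 hct, one_mul]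
    exact Finset.prod_congr rfl fun i _ => (Measure.restrict_apply (hs i)).symm
  rw [← Measure.restrict_pi_pi] at hpi
  have h := congrArg (fun μ => c * μ B) hpi
  beta_reduce at h
  rw [Measure.restrict_eq_self _ hBA, Measure.smul_apply, Measure.restrict_eq_self _ hBA,
    smul_eq_mul, ← mul_assoc, ENNReal.mul_inv_cancel hc0 hct, one_mul] at h
  refine h.le.trans ?_
  rw [Measure.map_apply hYm hB, Measure.map_apply hYm hB]
  exact Measure.restrict_apply_le _ _

/-- Boxes of annuli with rational radii form a countable cover. On the part of a box where the
squared outer radius exceeds `‖x l‖²` by at most `ε`, the density is at most `exp(λπε)` times the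
constant of the box. -/
theorem withDensity_nearestPointsDensity_le_smul_map
    (hX : IsPoissonProcess P (ENNReal.ofReal lam • (volume : Measure ℂ)) X) (hlam : 0 < lam)
    (hord : ∀ᵐ ω ∂P, Monotone fun i => ‖X i ω‖) {n : ℕ} (hn : 0 < n) {ε : ℝ} (hε : 0 < ε) :
    (volume : Measure (Fin n → ℂ)).withDensity
        (fun x => nearestPointsDensity lam hn fun i => ‖x i‖) ≤
      ENNReal.ofReal (Real.exp (lam * Real.pi * ε)) • P.map (fun ω (i : Fin n) => X i ω) := by
  set l : Fin n := ⟨n - 1, Nat.sub_lt hn one_pos⟩ with hl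
  have hil : ∀ i : Fin n, i ≤ l := fun i => Fin.le_def.2 (Nat.le_sub_one_of_lt i.2)
  let ι := {q : (Fin n → ℚ) × (Fin n → ℚ) // (∀ i j, i < j → q.2 i ≤ q.1 j) ∧
    (∀ i, q.2 i ≤ q.2 l) ∧ 0 ≤ q.2 l}
  let A : ι → Fin n → Set ℂ := fun q i => {z | (q.1.1 i : ℝ) < ‖z‖ ∧ ‖z‖ ≤ q.1.2 i}
  let V : ι → Set (Fin n → ℂ) := fun q => Set.univ.pi (A q) ∩
    {x | (q.1.2 l : ℝ) ^ 2 - ε ≤ ‖x l‖ ^ 2}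
  have hAm : ∀ q i, MeasurableSet (A q i) := fun q i =>
    (measurableSet_lt measurable_const measurable_norm).inter
      (measurableSet_le measurable_norm measurable_const)
  have hdm : Measurable fun x : Fin n → ℂ => nearestPointsDensity lam hn fun i => ‖x i‖ :=
    (measurable_nearestPointsDensity lam hn).comp (by fun_prop)
  refine Measure.le_of_forall_subset_countable_cover (V := V) (fun q => ?_) ?_ ?_
  · exact (MeasurableSet.univ_pi (hAm q)).inter (measurableSet_le measurable_const (by fun_prop))
  · intro q B hB hBV
    set b : ℝ := (q.1.2 l : ℝ) with hb
    have hb0 : 0 ≤ b := Rat.cast_nonneg.2 q.2.2.2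
    have hle := hX.ofReal_mul_volume_le_map hlam hord hb0 (hAm q)
      (fun i j hij z hz w hw => by
        have h1 : (q.1.2 i : ℝ) ≤ q.1.1 j := by exact_mod_cast q.2.1 i j hij
        exact hz.2.trans_lt (h1.trans_lt hw.1))
      (fun i z hz => by
        have h1 : (q.1.2 i : ℝ) ≤ b := Rat.cast_le.2 (q.2.2.1 i)
        simpa using hz.2.trans h1) hB (hBV.trans Set.inter_subset_left)
    rw [Measure.smul_apply, smul_eq_mul]
    refine le_trans ?_ (mul_le_mul_right hle _)
    rw [withDensity_apply _ hB, ← mul_assoc, ← ENNReal.ofReal_mul (Real.exp_pos _).le,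
      ← setLIntegral_const]
    refine setLIntegral_mono measurable_const fun x hx => ?_
    have hx2 : b ^ 2 - ε ≤ ‖x l‖ ^ 2 := (hBV hx).2
    unfold nearestPointsDensity
    split_ifs
    · refine ENNReal.ofReal_le_ofReal ?_
      rw [mul_left_comm, ← Real.exp_add]
      have : 0 < lam * Real.pi := mul_pos hlam Real.pi_pos
      gcongr
      change -(lam * Real.pi * ‖x l‖ ^ 2) ≤ _
      nlinarith
    · exact zero_le
  -- The density vanishes unless the norms increase strictly, so only such configurations must be
  -- covered. Then rational radii within a small `δ` of the norms give separated annuli.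
  · rw [withDensity_apply_eq_zero hdm]
    refine measure_mono_null (t := ∅) ?_ measure_empty
    rintro x ⟨hx1, hx2⟩
    apply hx2
    have hx : StrictMono fun i => ‖x i‖ := by
      by_contra hcon
      exact hx1 (if_neg hcon)
    have hev : ∀ᶠ δ : ℝ in nhdsWithin 0 (Set.Ioi 0),
        (∀ i j, i < j → ‖x i‖ + δ < ‖x j‖ - δ) ∧ (‖x l‖ + δ) ^ 2 - ε < ‖x l‖ ^ 2 := by
      refine (Filter.Eventually.and ?_ ?_).filter_mono nhdsWithin_le_nhds
      · refine Filter.eventually_all.2 fun i => Filter.eventually_all.2 fun j =>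
          Filter.eventually_all.2 fun hij => ?_
        have h1 : Filter.Tendsto (fun δ : ℝ => ‖x i‖ + δ) (nhds 0) (nhds (‖x i‖ + 0)) :=
          Continuous.tendsto (by fun_prop) 0
        have h2 : Filter.Tendsto (fun δ : ℝ => ‖x j‖ - δ) (nhds 0) (nhds (‖x j‖ - 0)) :=
          Continuous.tendsto (by fun_prop) 0
        exact h1.eventually_lt h2 (by simpa using hx hij)
      · have h1 : Filter.Tendsto (fun δ : ℝ => (‖x l‖ + δ) ^ 2 - ε) (nhds 0)
          (nhds ((‖x l‖ + 0) ^ 2 - ε)) := Continuous.tendsto (by fun_prop) 0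
        exact h1.eventually_lt tendsto_const_nhds (by simpa using hε)
    obtain ⟨δ, ⟨hδ1, hδ2⟩, hδ0⟩ := (hev.and self_mem_nhdsWithin).exists
    have hδ0 : 0 < δ := hδ0
    have ha : ∀ i, ∃ a : ℚ, ‖x i‖ - δ < a ∧ (a : ℝ) < ‖x i‖ := fun i => exists_rat_btwn (by linarith)
    have hb : ∀ i, ∃ a : ℚ, ‖x i‖ < a ∧ (a : ℝ) < ‖x i‖ + δ := fun i => exists_rat_btwn (by linarith)
    choose a ha1 ha2 using ha
    choose b hb1 hb2 using hb
    refine Set.mem_iUnion.2 ⟨⟨(a, b), fun i j hij => ?_, fun i => ?_, ?_⟩, fun i _ => ?_, ?_⟩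
    · have : (b i : ℝ) ≤ a j := by linarith [hδ1 i j hij, hb2 i, ha1 j]
      exact_mod_cast this
    · rcases (hil i).eq_or_lt with h | h
      · rw [h]
      · have : (b i : ℝ) ≤ b l := by linarith [hδ1 i l h, hb2 i, hb1 l]
        exact_mod_cast this
    · have : (0 : ℝ) ≤ b l := (norm_nonneg _).trans (hb1 l).le
      exact_mod_cast this
    · exact ⟨ha2 i, (hb1 i).le⟩
    · change (b l : ℝ) ^ 2 - ε ≤ ‖x l‖ ^ 2
      have : (b l : ℝ) ^ 2 ≤ (‖x l‖ + δ) ^ 2 :=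
        pow_le_pow_left₀ ((norm_nonneg _).trans (hb1 l).le) (hb2 l).le 2
      linarith

theorem withDensity_nearestPointsDensity_le_map [IsProbabilityMeasure P]
    (hX : IsPoissonProcess P (ENNReal.ofReal lam • (volume : Measure ℂ)) X) (hlam : 0 < lam)
    (hord : ∀ᵐ ω ∂P, Monotone fun i => ‖X i ω‖) {n : ℕ} (hn : 0 < n) :
    (volume : Measure (Fin n → ℂ)).withDensity
        (fun x => nearestPointsDensity lam hn fun i => ‖x i‖) ≤
      P.map (fun ω (i : Fin n) => X i ω) := by
  intro B
  have h1 : Filter.Tendsto (fun ε : ℝ => ENNReal.ofReal (Real.exp (lam * Real.pi * ε)) *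
      P.map (fun ω (i : Fin n) => X i ω) B) (nhdsWithin 0 (Set.Ioi 0))
      (nhds (ENNReal.ofReal (Real.exp (lam * Real.pi * 0)) *
        P.map (fun ω (i : Fin n) => X i ω) B)) := by
    have : IsFiniteMeasure (P.map fun ω (i : Fin n) => X i ω) := inferInstance
    refine ENNReal.Tendsto.mul_const ?_ (Or.inr (measure_ne_top _ _))
    exact ((ENNReal.continuous_ofReal.comp (by fun_prop)).tendsto (0 : ℝ)).mono_left
      nhdsWithin_le_nhds
  rw [mul_zero, Real.exp_zero, ENNReal.ofReal_one, one_mul] at h1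
  refine ge_of_tendsto h1 ?_
  filter_upwards [self_mem_nhdsWithin] with ε hε
  exact hX.withDensity_nearestPointsDensity_le_smul_map hlam hord hn hε B

end IsPoissonProcess

/-! ### Polar coordinates, relative angles and total mass -/

theorem lintegral_pi_fin_succ {E : Type*} [MeasurableSpace E] (μ : Measure E) [SigmaFinite μ]
    {m : ℕ} (i : Fin (m + 1)) {F : (Fin (m + 1) → E) → ℝ≥0∞} (hF : Measurable F) :
    ∫⁻ s, F s ∂(Measure.pi fun _ => μ) =
      ∫⁻ a, ∫⁻ s, F (i.insertNth a s) ∂(Measure.pi fun _ => μ) ∂μ := by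
  have h := (measurePreserving_piFinSuccAbove (fun _ : Fin (m + 1) => μ) i).symm
  rw [← h.lintegral_comp hF]
  exact lintegral_prod _ (hF.comp (MeasurableEquiv.measurable _)).aemeasurable

theorem lintegral_pi_polar {n : ℕ} {H : (Fin n → ℂ) → ℝ≥0∞} (hH : Measurable H) :
    ∫⁻ x, H x = ∫⁻ s, (∏ i, ENNReal.ofReal (s i)) *
      ∫⁻ φ, H (fun i => (s i : ℂ) * unitVec (φ i))
        ∂(Measure.pi fun _ => (volume : Measure ℝ).restrict (Set.Ioo (-Real.pi) Real.pi))
      ∂(Measure.pi fun _ : Fin n => (volume : Measure ℝ).restrict (Set.Ioi 0)) := by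
  have hu := continuous_unitVec.measurable
  have hsymm : ∀ p : ℝ × ℝ, Complex.polarCoord.symm p = (p.1 : ℂ) * unitVec p.2 := fun p => by
    rw [Complex.polarCoord_symm_apply, unitVec_eq_exp, Complex.exp_mul_I]; simp
  have hm : Measurable fun q : (Fin n → ℝ) × (Fin n → ℝ) => (∏ i, ENNReal.ofReal (q.1 i)) *
      H (fun i => (q.1 i : ℂ) * unitVec (q.2 i)) :=
    Measurable.mul (by fun_prop) (hH.comp (by fun_prop))
  have h := (measurePreserving_arrowProdEquivProdArrow ℝ ℝ (Fin n)
    (fun _ => (volume : Measure ℝ).restrict (Set.Ioi 0))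
    (fun _ => (volume : Measure ℝ).restrict (Set.Ioo (-Real.pi) Real.pi))).lintegral_comp hm
  rw [lintegral_prod _ hm.aemeasurable] at h
  rw [← Complex.lintegral_comp_pi_polarCoord_symm, volume_pi, Measure.restrict_pi_pi]
  simp_rw [Complex.polarCoord_target, Measure.volume_eq_prod, ← Measure.prod_restrict, hsymm]
  refine h.trans (lintegral_congr fun s => ?_)
  have hs : Measurable fun φ : Fin n → ℝ => H (fun i => (s i : ℂ) * unitVec (φ i)) :=
    hH.comp (by fun_prop)
  exact lintegral_const_mul (∏ i, ENNReal.ofReal (s i)) hs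

theorem Function.Periodic.setLIntegral_Ioc_eq {f : ℝ → ℝ≥0∞} {T : ℝ} (hf : Function.Periodic f T)
    (hT : 0 < T) (a b : ℝ) :
    ∫⁻ x in Set.Ioc a (a + T), f x = ∫⁻ x in Set.Ioc b (b + T), f x := by
  have : VAddInvariantMeasure (AddSubgroup.zmultiples T) ℝ volume :=
    ⟨fun c s _ => measure_preimage_add _ _ _⟩
  exact IsAddFundamentalDomain.setLIntegral_eq (G := AddSubgroup.zmultiples T)
    (isAddFundamentalDomain_Ioc hT a) (isAddFundamentalDomain_Ioc hT b) f hf.map_vadd_zmultiples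

theorem Function.Periodic.setLIntegral_Ioc_sub_eq {f : ℝ → ℝ≥0∞} {T : ℝ}
    (hf : Function.Periodic f T) (hT : 0 < T) (a b α : ℝ) :
    ∫⁻ x in Set.Ioc a (a + T), f (x - α) = ∫⁻ x in Set.Ioc b (b + T), f x := by
  have h := (measurePreserving_sub_right (volume : Measure ℝ) α).setLIntegral_comp_preimage_emb
    (MeasurableEquiv.subRight α).measurableEmbedding f (Set.Ioc (a - α) (a - α + T))
  have hpre : (fun x => x - α) ⁻¹' Set.Ioc (a - α) (a - α + T) = Set.Ioc a (a + T) := by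
    ext x
    simp only [Set.mem_preimage, Set.mem_Ioc]
    constructor <;> rintro ⟨h1, h2⟩ <;> constructor <;> linarith
  rw [← hf.setLIntegral_Ioc_eq hT (a - α) b, ← h, hpre]

/-- Both intervals are one full period of `unitVec` up to null endpoints, and a shift of the angle
only moves the period. -/
theorem map_unitVec_sub_restrict (α : ℝ) :
    Measure.map (fun φ => unitVec (φ - α))
        ((volume : Measure ℝ).restrict (Set.Ioo (-Real.pi) Real.pi)) =
      Measure.map unitVec ((volume : Measure ℝ).restrict (Set.Icc 0 (2 * Real.pi))) := by
  have hu := continuous_unitVec.measurable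
  refine Measure.ext fun B hB => ?_
  have hper : Function.Periodic (fun φ => B.indicator (1 : ℂ → ℝ≥0∞) (unitVec φ))
      (2 * Real.pi) := fun φ => by
    beta_reduce; rw [unitVec_periodic φ]
  have h := hper.setLIntegral_Ioc_sub_eq Real.two_pi_pos (-Real.pi) 0 α
  rw [show -Real.pi + 2 * Real.pi = Real.pi by ring, zero_add,
    ← Measure.restrict_congr_set Ioo_ae_eq_Ioc,
    Measure.restrict_congr_set (Ioc_ae_eq_Icc (α := ℝ) (μ := volume))] at h
  rw [← lintegral_indicator_one hB, ← lintegral_indicator_one hB,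
    lintegral_map (measurable_one.indicator hB) (by fun_prop),
    lintegral_map (measurable_one.indicator hB) hu]
  exact h

/-- Only the angles relative to the last one matter for a function that is integrated over all
the directions. -/
theorem lintegral_pi_unitVec_sub_last {m : ℕ} {h : (Fin (m + 1) → ℂ) → ℝ≥0∞} (hh : Measurable h) :
    ∫⁻ φ, h (fun i => unitVec (φ i - φ (Fin.last m)))
        ∂(Measure.pi fun _ => (volume : Measure ℝ).restrict (Set.Ioo (-Real.pi) Real.pi)) =
      ENNReal.ofReal (2 * Real.pi) * ∫⁻ φ in angleBox (m + 1),
        h (fun i => unitVec (extendAngles φ i)) := by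
  have hu := continuous_unitVec.measurable
  have hm : Measurable fun φ : Fin (m + 1) → ℝ =>
    h (fun i => unitVec (φ i - φ (Fin.last m))) := hh.comp (by fun_prop)
  rw [lintegral_pi_fin_succ _ (Fin.last m) hm]
  have hg : Measurable fun w : Fin m → ℂ => h ((Fin.last m).insertNth 1 w) :=
    hh.comp ((MeasurableEquiv.piFinSuccAbove (fun _ : Fin (m + 1) => ℂ)
      (Fin.last m)).symm.measurable.comp measurable_prodMk_left)
  have hins : ∀ α (φ : Fin m → ℝ), (fun i => unitVec ((Fin.last m).insertNth (α := fun _ => ℝ) α φ i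
      - (Fin.last m).insertNth (α := fun _ => ℝ) α φ (Fin.last m))) =
      (Fin.last m).insertNth (α := fun _ => ℂ) 1 (fun i => unitVec (φ i - α)) := by
    intro α φ
    refine (Fin.eq_insertNth_iff).2 ⟨?_, ?_⟩
    · apply Complex.ext <;> simp [unitVec]
    · ext i; simp [Fin.removeNth]
  have hext : ∀ φ : Fin m → ℝ, (fun i => unitVec (extendAngles (n := m + 1) φ i)) =
      (Fin.last m).insertNth (α := fun _ => ℂ) 1 (fun i => unitVec (φ i)) := by
    intro φ
    refine (Fin.eq_insertNth_iff).2 ⟨?_, ?_⟩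
    · apply Complex.ext <;> simp [unitVec, extendAngles]
    · ext i; simp [Fin.removeNth, extendAngles]
  -- The inner integral sees the angles only through the laws of their directions, which do not
  -- depend on the last angle `α`. Integrating over `α` then gives the factor `2π`.
  have hmap : ∀ α, ∫⁻ φ : Fin m → ℝ, h ((Fin.last m).insertNth (α := fun _ => ℂ) 1
      (fun i => unitVec (φ i - α)))
      ∂(Measure.pi fun _ => (volume : Measure ℝ).restrict (Set.Ioo (-Real.pi) Real.pi)) =
      ∫⁻ φ : Fin m → ℝ, h ((Fin.last m).insertNth (α := fun _ => ℂ) 1 (fun i => unitVec (φ i)))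
      ∂(Measure.pi fun _ => (volume : Measure ℝ).restrict (Set.Icc 0 (2 * Real.pi))) := by
    intro α
    have hf1 : ∀ β, IsFiniteMeasure (Measure.map (fun φ => unitVec (φ - β))
      ((volume : Measure ℝ).restrict (Set.Ioo (-Real.pi) Real.pi))) := fun β => inferInstance
    have hf2 : IsFiniteMeasure (Measure.map unitVec
      ((volume : Measure ℝ).restrict (Set.Icc 0 (2 * Real.pi)))) := inferInstance
    have h1 := Measure.pi_map_pi (ι := Fin m)
      (μ := fun _ => (volume : Measure ℝ).restrict (Set.Ioo (-Real.pi) Real.pi))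
      (f := fun _ φ => unitVec (φ - α)) (fun _ => Measurable.aemeasurable (by fun_prop))
    have h2 := Measure.pi_map_pi (ι := Fin m)
      (μ := fun _ => (volume : Measure ℝ).restrict (Set.Icc 0 (2 * Real.pi)))
      (f := fun _ φ => unitVec φ) (fun _ => hu.aemeasurable)
    have h1' := lintegral_map (μ := Measure.pi fun _ : Fin m =>
      (volume : Measure ℝ).restrict (Set.Ioo (-Real.pi) Real.pi)) hg
      (g := fun φ i => unitVec (φ i - α)) (by fun_prop)
    have h2' := lintegral_map (μ := Measure.pi fun _ : Fin m =>
      (volume : Measure ℝ).restrict (Set.Icc 0 (2 * Real.pi))) hg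
      (g := fun φ i => unitVec (φ i)) (by fun_prop)
    rw [← h1', ← h2', h1, h2]
    simp_rw [map_unitVec_sub_restrict]
  simp_rw [hins, hmap, hext]
  rw [lintegral_const, Measure.restrict_apply_univ, Real.volume_Ioo, mul_comm]
  congr 1
  · congr 1; ring
  · rw [angleBox, volume_pi, Measure.restrict_pi_pi]
    rfl

theorem setLIntegral_Ioi_rayleigh {lam : ℝ} (hlam : 0 < lam) {t : ℝ} (ht : 0 ≤ t) :
    ∫⁻ a in Set.Ioi t, ENNReal.ofReal (2 * Real.pi * lam * a) *
      ENNReal.ofReal (Real.exp (-(lam * Real.pi * a ^ 2))) =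
      ENNReal.ofReal (Real.exp (-(lam * Real.pi * t ^ 2))) := by
  have hpi := Real.pi_pos
  have hder : ∀ x ∈ Set.Ici t, HasDerivAt (fun a => -Real.exp (-(lam * Real.pi * a ^ 2)))
      (2 * Real.pi * lam * x * Real.exp (-(lam * Real.pi * x ^ 2))) x := by
    intro x _
    have h : HasDerivAt (fun a : ℝ => -(lam * Real.pi * a ^ 2)) (-(lam * Real.pi * (2 * x))) x := by
      simpa using ((hasDerivAt_pow 2 x).const_mul (lam * Real.pi)).fun_neg
    exact h.exp.fun_neg.congr_deriv (by ring)
  have hlim : Filter.Tendsto (fun a : ℝ => -Real.exp (-(lam * Real.pi * a ^ 2))) Filter.atTop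
      (nhds 0) := by
    rw [← neg_zero]
    refine (Real.tendsto_exp_neg_atTop_nhds_zero.comp ?_).neg
    exact (Filter.tendsto_pow_atTop two_ne_zero).const_mul_atTop (by positivity)
  have hnn : ∀ x ∈ Set.Ioi t, 0 ≤ 2 * Real.pi * lam * x * Real.exp (-(lam * Real.pi * x ^ 2)) :=
    fun x hx => by
      have : 0 < x := ht.trans_lt hx
      positivity
  have hint := integrableOn_Ioi_deriv_of_nonneg' hder hnn hlim
  have hval := integral_Ioi_of_hasDerivAt_of_nonneg' hder hnn hlim
  rw [zero_sub, neg_neg] at hval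
  rw [← hval, ofReal_integral_eq_lintegral_ofReal hint
    ((ae_restrict_iff' measurableSet_Ioi).2 (Filter.Eventually.of_forall hnn))]
  refine setLIntegral_congr_fun measurableSet_Ioi fun x hx => ?_
  have : 0 < x := ht.trans_lt hx
  exact (ENNReal.ofReal_mul (by positivity)).symm

open Classical in
theorem measurable_rayleigh_chain (lam : ℝ) (k : ℕ) (t : ℝ) :
    Measurable fun s : Fin k → ℝ => (∏ i, ENNReal.ofReal (2 * Real.pi * lam * s i)) *
      (if StrictMono (Fin.cons t s : Fin (k + 1) → ℝ) then ENNReal.ofReal (Real.exp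
        (-(lam * Real.pi * (Fin.cons t s : Fin (k + 1) → ℝ) (Fin.last k) ^ 2))) else 0) := by
  have hcons : Measurable fun s : Fin k → ℝ => (Fin.cons t s : Fin (k + 1) → ℝ) := by
    refine measurable_pi_lambda _ fun i => ?_
    refine Fin.cases ?_ (fun j => ?_) i
    · simp
    · simp only [Fin.cons_succ]; fun_prop
  refine Measurable.mul (by fun_prop) (Measurable.ite
    ((measurableSet_setOf_strictMono _).preimage hcons) ?_ measurable_const)
  have := (measurable_pi_apply (Fin.last k)).comp hcons
  exact ((this.pow_const 2).const_mul _).neg.exp.ennreal_ofReal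

-- Prefixing a lower bound `t` lets the induction close: once the smallest radius `a > t` is split
-- off, the remaining integral is the same statement at `a`, and the Rayleigh tail integral over `a`
-- brings back the form at `t`.
open Classical in
theorem lintegral_pi_rayleigh_chain {lam : ℝ} (hlam : 0 < lam) (m : ℕ) {t : ℝ} (ht : 0 ≤ t) :
    ∫⁻ s : Fin m → ℝ, (∏ i, ENNReal.ofReal (2 * Real.pi * lam * s i)) *
      (if StrictMono (Fin.cons t s : Fin (m + 1) → ℝ) then ENNReal.ofReal (Real.exp
        (-(lam * Real.pi * (Fin.cons t s : Fin (m + 1) → ℝ) (Fin.last m) ^ 2))) else 0)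
      ∂(Measure.pi fun _ => (volume : Measure ℝ).restrict (Set.Ioi 0)) =
      ENNReal.ofReal (Real.exp (-(lam * Real.pi * t ^ 2))) := by
  induction m generalizing t with
  | zero =>
    have hs : ∀ s : Fin 0 → ℝ, StrictMono (Fin.cons t s : Fin 1 → ℝ) := fun s =>
      fun i j hij => absurd hij (by rw [Fin.lt_def]; omega)
    simp [hs]
  | succ m ih =>
    have hchain : ∀ (a : ℝ) (s : Fin m → ℝ),
        StrictMono (Fin.cons t (Fin.cons a s : Fin (m + 1) → ℝ) : Fin (m + 2) → ℝ) ↔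
        t < a ∧ StrictMono (Fin.cons a s : Fin (m + 1) → ℝ) := by
      intro a s
      rw [Fin.strictMono_iff_lt_succ (n := m + 1), Fin.forall_fin_succ, Fin.strictMono_iff_lt_succ]
      simp
    rw [lintegral_pi_fin_succ _ 0 (measurable_rayleigh_chain lam (m + 1) t), ← setLIntegral_Ioi_rayleigh hlam ht,
      ← lintegral_indicator measurableSet_Ioi, ← lintegral_indicator measurableSet_Ioi]
    refine lintegral_congr fun a => ?_
    by_cases hta : t < a
    · have ha : 0 < a := ht.trans_lt hta
      rw [Set.indicator_of_mem (Set.mem_Ioi.2 ha), Set.indicator_of_mem (Set.mem_Ioi.2 hta),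
        ← ih ha.le, ← lintegral_const_mul _ (measurable_rayleigh_chain lam m a)]
      refine lintegral_congr fun s => ?_
      rw [Fin.insertNth_zero', Fin.prod_univ_succ, Fin.cons_zero, mul_assoc]
      simp only [Fin.cons_succ, hchain, hta, true_and, ← Fin.succ_last]
    · rw [Set.indicator_of_notMem (s := Set.Ioi t) (by simpa using hta)]
      refine Set.indicator_apply_eq_zero.2 fun _ => ?_
      simp [Fin.insertNth_zero', hchain, hta]

theorem ae_forall_pos (n : ℕ) :
    ∀ᵐ s ∂(Measure.pi fun _ : Fin n => (volume : Measure ℝ).restrict (Set.Ioi 0)),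
      ∀ i, 0 < s i := by
  rw [← Measure.restrict_pi_pi]
  filter_upwards [ae_restrict_mem (MeasurableSet.univ_pi fun _ => measurableSet_Ioi)] with s hs i
  exact hs i trivial

theorem norm_mul_unitVec {s : ℝ} (hs : 0 < s) (φ : ℝ) : ‖(s : ℂ) * unitVec φ‖ = s := by
  rw [norm_mul, norm_unitVec, mul_one, Complex.norm_real, Real.norm_of_nonneg hs.le]

/-- The angles contribute `(2π)^n`, which makes each radius a factor of Rayleigh type, and the
radial chain then integrates to 1. This mass turns domination of measures into equality. -/
theorem lintegral_nearestPointsDensity {lam : ℝ} (hlam : 0 < lam) {n : ℕ} (hn : 0 < n) :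
    ∫⁻ x : Fin n → ℂ, nearestPointsDensity lam hn (fun i => ‖x i‖) = 1 := by
  classical
  obtain ⟨m, rfl⟩ := Nat.exists_eq_add_one_of_ne_zero hn.ne'
  have hd := measurable_nearestPointsDensity lam hn
  have hd' : Measurable fun x : Fin (m + 1) → ℂ => nearestPointsDensity lam hn (fun i => ‖x i‖) :=
    hd.comp (by fun_prop)
  have h0 := setLIntegral_Ioi_rayleigh hlam le_rfl
  rw [zero_pow two_ne_zero, mul_zero, neg_zero, Real.exp_zero, ENNReal.ofReal_one] at h0
  have hFm : Measurable fun s : Fin (m + 1) → ℝ =>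
      (∏ i, ENNReal.ofReal (2 * Real.pi * lam * s i)) *
      (if StrictMono s then ENNReal.ofReal (Real.exp
        (-(lam * Real.pi * s (Fin.last m) ^ 2))) else 0) :=
    Measurable.mul (by fun_prop)
      (Measurable.ite (measurableSet_setOf_strictMono _) (by fun_prop) measurable_const)
  have hcongr : ∀ᵐ s ∂(Measure.pi fun _ : Fin (m + 1) => (volume : Measure ℝ).restrict (Set.Ioi 0)),
      (∏ i, ENNReal.ofReal (s i)) *
        ∫⁻ φ : Fin (m + 1) → ℝ, nearestPointsDensity lam hn
          (fun i => ‖(s i : ℂ) * unitVec (φ i)‖)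
        ∂(Measure.pi fun _ => (volume : Measure ℝ).restrict (Set.Ioo (-Real.pi) Real.pi)) =
      (∏ i, ENNReal.ofReal (2 * Real.pi * lam * s i)) *
      (if StrictMono s then ENNReal.ofReal (Real.exp
        (-(lam * Real.pi * s (Fin.last m) ^ 2))) else 0) := by
    filter_upwards [ae_forall_pos (m + 1)] with s hs
    have hpi := Real.pi_pos
    simp_rw [fun i φ => norm_mul_unitVec (hs i) φ, lintegral_const, Measure.pi_univ,
      Measure.restrict_apply_univ, Real.volume_Ioo, Finset.prod_const, Finset.card_univ,
      Fintype.card_fin, nearestPointsDensity]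
    split_ifs with h
    · have h1 : ∀ i, ENNReal.ofReal (2 * Real.pi * lam * s i) = ENNReal.ofReal (s i) *
          (ENNReal.ofReal lam * ENNReal.ofReal (Real.pi - -Real.pi)) := fun i => by
        rw [← ENNReal.ofReal_mul hlam.le, ← ENNReal.ofReal_mul (hs i).le]
        congr 1; ring
      simp_rw [h1]
      rw [Finset.prod_mul_distrib, Finset.prod_const, Finset.card_univ, Fintype.card_fin,
        ENNReal.ofReal_mul (pow_nonneg hlam.le _), ENNReal.ofReal_pow hlam.le, mul_pow]
      have : (⟨m + 1 - 1, Nat.sub_lt hn one_pos⟩ : Fin (m + 1)) = Fin.last m := rfl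
      rw [this]
      ring
    · simp
  rw [lintegral_pi_polar hd', lintegral_congr_ae hcongr, lintegral_pi_fin_succ _ 0 hFm, ← h0]
  refine setLIntegral_congr_fun measurableSet_Ioi fun a ha => ?_
  beta_reduce
  rw [← lintegral_pi_rayleigh_chain hlam m (le_of_lt ha), 
    ← lintegral_const_mul _ (measurable_rayleigh_chain lam m a)]
  refine lintegral_congr fun s => ?_
  rw [Fin.insertNth_zero', Fin.prod_univ_succ, Fin.cons_zero, mul_assoc]
  simp only [Fin.cons_succ]

namespace IsPoissonProcess

/-- The joint law of the `n` points of a planar Poisson process nearest to the origin. -/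
theorem map_eq_withDensity_nearestPointsDensity {Ω : Type*} [MeasurableSpace Ω] {P : Measure Ω}
    [IsProbabilityMeasure P] {X : ℕ → Ω → ℂ} {lam : ℝ}
    (hX : IsPoissonProcess P (ENNReal.ofReal lam • (volume : Measure ℂ)) X) (hlam : 0 < lam)
    (hord : ∀ᵐ ω ∂P, Monotone fun i => ‖X i ω‖) {n : ℕ} (hn : 0 < n) :
    P.map (fun ω (i : Fin n) => X i ω) = (volume : Measure (Fin n → ℂ)).withDensity
        (fun x => nearestPointsDensity lam hn fun i => ‖x i‖) := by
  have hYm : Measurable fun ω (i : Fin n) => X i ω :=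
    measurable_pi_lambda _ fun i => hX.measurable i
  have hprob : IsProbabilityMeasure (P.map fun ω (i : Fin n) => X i ω) :=
    Measure.isProbabilityMeasure_map hYm.aemeasurable
  have hmass : (volume : Measure (Fin n → ℂ)).withDensity
        (fun x => nearestPointsDensity lam hn fun i => ‖x i‖) Set.univ = 1 := by
    rw [withDensity_apply _ MeasurableSet.univ, Measure.restrict_univ,
      lintegral_nearestPointsDensity hlam hn]
  have hfin : IsFiniteMeasure ((volume : Measure (Fin n → ℂ)).withDensity
        (fun x => nearestPointsDensity lam hn fun i => ‖x i‖)) := ⟨by simp [hmass]⟩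
  exact (Measure.eq_of_le_of_measure_univ_eq
    (hX.withDensity_nearestPointsDensity_le_map hlam hord hn) (by rw [hmass, measure_univ])).symm

end IsPoissonProcess

/-! ### Rotations and isotropic blockages -/

theorem rotateToAxis_mul_unitVec {s : ℝ} (hs : 0 < s) (r φ α : ℝ) :
    rotateToAxis ((s : ℂ) * unitVec α) ((r : ℂ) * unitVec φ) = (r : ℂ) * unitVec (φ - α) := by
  have : (s : ℂ) ≠ 0 := Complex.ofReal_ne_zero.2 hs.ne'
  rw [rotateToAxis, norm_mul_unitVec hs, map_mul, Complex.conj_ofReal, conj_unitVec,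
    sub_eq_add_neg, unitVec_add]
  field_simp

theorem measurable_rotateToAxis : Measurable fun q : ℂ × ℂ => rotateToAxis q.1 q.2 := by
  unfold rotateToAxis
  have := Complex.continuous_conj.measurable
  fun_prop

section Isotropic

theorem parallelogram_add_pi (r φ ℓ θ : ℝ) :
    parallelogram r φ ℓ (θ + Real.pi) = parallelogram r φ ℓ θ := by
  have h : ∀ ψ ψ', unitVec ψ' = -unitVec ψ → parallelogram r φ ℓ ψ' ⊆ parallelogram r φ ℓ ψ := by
    rintro ψ ψ' h _ ⟨s, hs, t, ht, rfl⟩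
    refine ⟨s, hs, -t, ⟨by linarith [ht.2], by linarith [ht.1]⟩, ?_⟩
    rw [h]; push_cast; ring
  exact (h _ _ (unitVec_add_pi θ)).antisymm (h _ _ (by rw [unitVec_add_pi, neg_neg]))

theorem mem_parallelogram_add_iff (r φ ℓ θ α : ℝ) (z : ℂ) :
    unitVec α * z ∈ parallelogram r (φ + α) ℓ (θ + α) ↔ z ∈ parallelogram r φ ℓ θ := by
  have h0 : unitVec α ≠ 0 := norm_ne_zero_iff.1 (by simp)
  constructor
  · rintro ⟨s, hs, t, ht, h⟩
    refine ⟨s, hs, t, ht, mul_left_cancel₀ h0 (h.trans ?_)⟩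
    rw [unitVec_add, unitVec_add]; ring
  · rintro ⟨s, hs, t, ht, rfl⟩
    refine ⟨s, hs, t, ht, ?_⟩
    rw [unitVec_add, unitVec_add]; ring

/-- Rotation by `α` preserves area, so turning the links by `α` amounts to turning the blockage by
`-α`. -/
theorem volume_iUnion_parallelogram_add {n : ℕ} (S : Finset (Fin n)) (r φ : Fin n → ℝ)
    (ℓ θ α : ℝ) :
    (volume : Measure ℂ) (⋃ i ∈ S, parallelogram (r i) (φ i + α) ℓ θ) =
      (volume : Measure ℂ) (⋃ i ∈ S, parallelogram (r i) (φ i) ℓ (θ - α)) := by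
  have h := (rotation (Circle.exp α)).measurePreserving.measure_preimage_equiv
    (f := (rotation (Circle.exp α)).toMeasurableEquiv)
    (⋃ i ∈ S, parallelogram (r i) (φ i + α) ℓ θ)
  rw [← h]
  congr 1
  ext z
  have hz : (rotation (Circle.exp α)) z = unitVec α * z := by
    rw [rotation_apply, Circle.coe_exp, unitVec_eq_exp]
  have hi : ∀ i, (rotation (Circle.exp α)) z ∈ parallelogram (r i) (φ i + α) ℓ θ ↔
      z ∈ parallelogram (r i) (φ i) ℓ (θ - α) := fun i => by
    rw [hz, ← mem_parallelogram_add_iff (r i) (φ i) ℓ (θ - α) α z, sub_add_cancel]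
  simp only [Set.mem_preimage, Set.mem_iUnion]
  exact exists_congr fun i => exists_congr fun _ => hi i

/-- A blockage is unoriented, so the area has period `π` in `θ`, and a shift does not change its
integral over the full period `[0, π]`. -/
theorem meanUnionArea_add_of_uniform {FL : Measure ℝ} [IsProbabilityMeasure FL]
    {FT : Measure ℝ} [IsProbabilityMeasure FT]
    (hFL : ∀ᵐ ℓ ∂FL, 0 ≤ ℓ) (hFT : ∀ᵐ θ ∂FT, θ ∈ Set.Icc 0 Real.pi)
    (hunif : FT = ProbabilityTheory.cond volume (Set.Icc 0 Real.pi))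
    {n : ℕ} (S : Finset (Fin n)) (r φ : Fin n → ℝ) (α : ℝ) :
    meanUnionArea FL FT S r (fun i => φ i + α) = meanUnionArea FL FT S r φ := by
  rw [meanUnionArea_eq_toReal S hFL hFT, meanUnionArea_eq_toReal S hFL hFT,
    lintegral_prod _ (measurable_volume_iUnion_parallelogram_right S r _).aemeasurable,
    lintegral_prod _ (measurable_volume_iUnion_parallelogram_right S r _).aemeasurable]
  congr 1
  refine lintegral_congr fun ℓ => ?_
  have hper : Function.Periodic (fun θ => (volume : Measure ℂ)
      (⋃ i ∈ S, parallelogram (r i) (φ i) ℓ θ)) Real.pi := fun θ => by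
    simp_rw [parallelogram_add_pi]
  have h := hper.setLIntegral_Ioc_sub_eq Real.pi_pos 0 0 α
  rw [zero_add, Measure.restrict_congr_set (Ioc_ae_eq_Icc (α := ℝ) (μ := volume))] at h
  simp only [volume_iUnion_parallelogram_add, hunif, ProbabilityTheory.cond, lintegral_smul_measure]
  rw [h]

theorem inclExclSum_add_of_uniform {FL : Measure ℝ} [IsProbabilityMeasure FL]
    {FT : Measure ℝ} [IsProbabilityMeasure FT]
    (hFL : ∀ᵐ ℓ ∂FL, 0 ≤ ℓ) (hFT : ∀ᵐ θ ∂FT, θ ∈ Set.Icc 0 Real.pi)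
    (hunif : FT = ProbabilityTheory.cond volume (Set.Icc 0 Real.pi)) (mu : ℝ)
    {n : ℕ} (r φ : Fin n → ℝ) (α : ℝ) :
    inclExclSum mu FL FT r (fun i => φ i + α) = inclExclSum mu FL FT r φ := by
  simp only [inclExclSum, meanUnionArea_add_of_uniform hFL hFT hunif]

end Isotropic

/-! ### Averaging over the stations -/

/-- Two coordinates agree only on a proper subspace, which is null. This reconciles `Monotone` in
`distanceDensity` with `StrictMono` in `nearestPointsDensity`. -/
theorem ae_injective_fin (n : ℕ) : ∀ᵐ s : Fin n → ℝ, Function.Injective s := by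
  have h : ∀ i j : Fin n, i ≠ j → ∀ᵐ s : Fin n → ℝ, s i ≠ s j := by
    intro i j hij
    have hker : (LinearMap.ker ((LinearMap.proj i : (Fin n → ℝ) →ₗ[ℝ] ℝ) - LinearMap.proj j)) ≠ ⊤ := by
      intro htop
      have hm : Pi.single i (1 : ℝ) ∈
          (LinearMap.ker ((LinearMap.proj i : (Fin n → ℝ) →ₗ[ℝ] ℝ) - LinearMap.proj j)) :=
        htop ▸ Submodule.mem_top
      simp [LinearMap.mem_ker, Pi.single_eq_of_ne hij.symm] at hm
    have h0 := Measure.addHaar_submodule (volume : Measure (Fin n → ℝ)) _ hker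
    refine measure_mono_null (fun s hs => ?_) h0
    simpa [LinearMap.mem_ker, sub_eq_zero] using hs
  have h' : ∀ᵐ s : Fin n → ℝ, ∀ i j, i ≠ j → s i ≠ s j := by
    simp only [ae_all_iff]
    exact h
  filter_upwards [h'] with s hs i j hij
  by_contra hne
  exact hs i j hne hij

theorem restrict_positiveOrthant (n : ℕ) :
    (volume : Measure (Fin n → ℝ)).restrict (positiveOrthant n) =
      Measure.pi fun _ => (volume : Measure ℝ).restrict (Set.Ioi 0) := by
  rw [← Measure.restrict_pi_pi, ← volume_pi]
  congr 1
  ext s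
  simp [positiveOrthant]

theorem measurable_distanceDensity (lam : ℝ) {n : ℕ} (hn : 0 < n) :
    Measurable (distanceDensity lam hn) := by
  classical
  have hm : MeasurableSet {s : Fin n → ℝ | Monotone s} := by
    simp only [Monotone, Set.ofPred_forall]
    exact MeasurableSet.iInter fun i => MeasurableSet.iInter fun j => MeasurableSet.iInter fun _ =>
      measurableSet_le (measurable_pi_apply i) (measurable_pi_apply j)
  unfold distanceDensity
  exact Measurable.ite hm (by fun_prop) measurable_const

theorem distanceDensity_nonneg {lam : ℝ} (hlam : 0 < lam) {n : ℕ} (hn : 0 < n) {s : Fin n → ℝ}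
    (hs : ∀ i, 0 < s i) : 0 ≤ distanceDensity lam hn s := by
  unfold distanceDensity
  have := Real.pi_pos
  have h := Finset.prod_nonneg fun i (_ : i ∈ Finset.univ) => (hs i).le
  split_ifs <;> positivity

theorem ofReal_distanceDensity (lam : ℝ) {n : ℕ} (hn : 0 < n) {s : Fin n → ℝ}
    (hs : ∀ i, 0 < s i) (hinj : Function.Injective s) :
    ENNReal.ofReal (distanceDensity lam hn s) = ENNReal.ofReal (2 * Real.pi) ^ n *
      ((∏ i, ENNReal.ofReal (s i)) * nearestPointsDensity lam hn s) := by
  classical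
  have hiff : Monotone s ↔ StrictMono s :=
    ⟨fun h => h.strictMono_of_injective hinj, StrictMono.monotone⟩
  have hpi := Real.pi_pos
  have h := Finset.prod_nonneg fun i (_ : i ∈ Finset.univ) => (hs i).le
  unfold distanceDensity nearestPointsDensity
  simp only [hiff]
  split_ifs
  · rw [← ENNReal.ofReal_prod_of_nonneg fun i _ => (hs i).le, ← ENNReal.ofReal_pow (by positivity),
      ← ENNReal.ofReal_mul h, ← ENNReal.ofReal_mul (by positivity)]
    congr 1
    rw [mul_pow]; ring
  · simp

theorem measurable_extendAngles (n : ℕ) :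
    Measurable fun φ : Fin (n - 1) → ℝ => extendAngles φ := by
  refine measurable_pi_lambda _ fun i => ?_
  unfold extendAngles
  split_ifs <;> fun_prop

namespace IsCellularNetwork

variable {Ω : Type*} [MeasurableSpace Ω] {P : Measure Ω} [IsProbabilityMeasure P]
  {lam mu : ℝ} {FL FT : Measure ℝ} [IsProbabilityMeasure FL] [IsProbabilityMeasure FT]
  {X C : ℕ → Ω → ℂ} {L T : ℕ → Ω → ℝ}

theorem measurable_measure_iUnion_isLOS (hnet : IsCellularNetwork P lam mu FL FT X C L T) (n : ℕ) :
    Measurable fun y : Fin n → ℂ => P (⋃ i, {ω | IsLOS (y i)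
      (fun k => C k ω) (fun k => L k ω) (fun k => T k ω)}) := by
  have hB := hnet.measurable_blockages
  have hW : MeasurableSet (⋃ i : Fin n, (fun q : (Fin n → ℂ) × Ω =>
      (q.1 i, fun k => (C k q.2, L k q.2, T k q.2))) ⁻¹'
      {q : ℂ × (ℕ → ℂ × ℝ × ℝ) |
        IsLOS q.1 (fun k => (q.2 k).1) (fun k => (q.2 k).2.1) (fun k => (q.2 k).2.2)}) :=
    MeasurableSet.iUnion fun i => measurableSet_setOf_isLOS.preimage
      (((measurable_pi_apply i).comp measurable_fst).prodMk (hB.comp measurable_snd))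
  convert measurable_measure_prodMk_left (ν := P) hW using 3 with y
  simp only [Set.preimage_iUnion]
  rfl

theorem measure_iUnion_isLOS (hnet : IsCellularNetwork P lam mu FL FT X C L T) (hmu : 0 < mu)
    (hFL : ∀ᵐ ℓ ∂FL, 0 ≤ ℓ) (hmean : Integrable (fun ℓ : ℝ => ℓ) FL)
    (hFT : ∀ᵐ θ ∂FT, θ ∈ Set.Icc 0 Real.pi) {n : ℕ} (r φ : Fin n → ℝ) :
    P (⋃ i, {ω | IsLOS ((r i : ℂ) * unitVec (φ i))
      (fun k => C k ω) (fun k => L k ω) (fun k => T k ω)}) =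
      ENNReal.ofReal (inclExclSum mu FL FT r φ) := by
  rw [← hnet.measureReal_iUnion_isLOS hmu hFL hmean hFT, Measure.real,
    ENNReal.ofReal_toReal (measure_ne_top _ _)]

/-- The mean of a function of the nearest stations that depends only on the distances and on the
angles relative to the last station. -/
theorem lintegral_stations (hnet : IsCellularNetwork P lam mu FL FT X C L T) (hlam : 0 < lam)
    {m : ℕ} {F k : (Fin (m + 1) → ℂ) → ℝ≥0∞} (hF : Measurable F) (hk : Measurable k)
    (hFk : ∀ s φ : Fin (m + 1) → ℝ, (∀ i, 0 < s i) → F (fun i => (s i : ℂ) * unitVec (φ i)) =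
      k (fun i => (s i : ℂ) * unitVec (φ i - φ (Fin.last m)))) :
    ENNReal.ofReal (2 * Real.pi) ^ m * ∫⁻ ω, F (fun i => X i ω) ∂P =
      ∫⁻ q in angleBox (m + 1) ×ˢ positiveOrthant (m + 1),
        k (fun i => (q.2 i : ℂ) * unitVec (extendAngles q.1 i)) *
          ENNReal.ofReal (distanceDensity lam m.succ_pos q.2) := by
  have hu := continuous_unitVec.measurable
  have hXm : Measurable fun ω (i : Fin (m + 1)) => X i ω :=
    measurable_pi_lambda _ fun i => hnet.stations.measurable i
  have hd := measurable_nearestPointsDensity lam m.succ_pos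
  have hdn : Measurable fun x : Fin (m + 1) → ℂ =>
    nearestPointsDensity lam m.succ_pos (fun i => ‖x i‖) := hd.comp (by fun_prop)
  have hext := measurable_extendAngles (m + 1)
  have hkq : Measurable fun q : (Fin (m + 1 - 1) → ℝ) × (Fin (m + 1) → ℝ) =>
      k (fun i => (q.2 i : ℂ) * unitVec (extendAngles q.1 i)) := by
    refine hk.comp (measurable_pi_lambda _ fun i => ?_)
    have h1 : Measurable fun q : (Fin (m + 1 - 1) → ℝ) × (Fin (m + 1) → ℝ) =>
      extendAngles (n := m + 1) q.1 i := (measurable_pi_apply i).comp (hext.comp measurable_fst)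
    exact (Complex.measurable_ofReal.comp ((measurable_pi_apply i).comp measurable_snd)).mul
      (hu.comp h1)
  have hD := measurable_distanceDensity lam m.succ_pos
  have h1 : ∫⁻ ω, F (fun i => X i ω) ∂P =
      ∫⁻ x, nearestPointsDensity lam m.succ_pos (fun i => ‖x i‖) * F x := by
    rw [← lintegral_map hF hXm, hnet.stations.map_eq_withDensity_nearestPointsDensity hlam
      hnet.ordered m.succ_pos, lintegral_withDensity_eq_lintegral_mul _ hdn hF]
    rfl
  have hdF : Measurable fun x : Fin (m + 1) → ℂ =>
    nearestPointsDensity lam m.succ_pos (fun i => ‖x i‖) * F x := hdn.mul hF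
  have hkD : Measurable fun q : (Fin (m + 1 - 1) → ℝ) × (Fin (m + 1) → ℝ) =>
      k (fun i => (q.2 i : ℂ) * unitVec (extendAngles q.1 i)) *
        ENNReal.ofReal (distanceDensity lam m.succ_pos q.2) :=
    hkq.mul (hD.comp measurable_snd).ennreal_ofReal
  rw [h1, lintegral_pi_polar hdF, Measure.volume_eq_prod, ← Measure.prod_restrict,
    lintegral_prod_symm' _ hkD,
    ← lintegral_const_mul' _ _ (ENNReal.pow_ne_top ENNReal.ofReal_ne_top),
    restrict_positiveOrthant]
  refine lintegral_congr_ae ?_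
  have hinj : ∀ᵐ s ∂(Measure.pi fun _ : Fin (m + 1) => (volume : Measure ℝ).restrict (Set.Ioi 0)),
      Function.Injective s := by
    rw [← restrict_positiveOrthant]
    exact ae_restrict_of_ae (ae_injective_fin _)
  filter_upwards [ae_forall_pos (m + 1), hinj] with s hs hsi
  have hks : Measurable fun w : Fin (m + 1) → ℂ => k (fun i => (s i : ℂ) * w i) :=
    hk.comp (by fun_prop)
  have h2 := lintegral_pi_unitVec_sub_last hks
  have hkφ : Measurable fun φ : Fin (m + 1) → ℝ =>
      k (fun i => (s i : ℂ) * unitVec (φ i - φ (Fin.last m))) := hk.comp (by fun_prop)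
  simp_rw [fun φ => hFk s φ hs, fun i φ => norm_mul_unitVec (hs i) φ]
  rw [lintegral_const_mul _ hkφ, h2, ofReal_distanceDensity lam m.succ_pos hs hsi]
  have hkφ' : Measurable fun φ : Fin (m + 1 - 1) → ℝ =>
      k (fun i => (s i : ℂ) * unitVec (extendAngles φ i)) :=
    hkq.comp (measurable_id.prodMk measurable_const)
  -- Of the `m + 1` factors `2π` in the distance density, `m` match the prefactor and one is the
  -- integral over the last angle.
  rw [lintegral_mul_const _ hkφ', pow_succ]
  ring

end IsCellularNetwork

theorem measurable_inclExclSum {FL FT : Measure ℝ} [IsProbabilityMeasure FL]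
    [IsProbabilityMeasure FT] (hFL : ∀ᵐ ℓ ∂FL, 0 ≤ ℓ) (hFT : ∀ᵐ θ ∂FT, θ ∈ Set.Icc 0 Real.pi)
    (mu : ℝ) (n : ℕ) :
    Measurable fun q : (Fin n → ℝ) × (Fin n → ℝ) => inclExclSum mu FL FT q.1 q.2 := by
  unfold inclExclSum
  exact Finset.measurable_fun_sum _ fun S _ =>
    (((measurable_meanUnionArea S hFL hFT).const_mul mu).neg.exp).const_mul _

namespace IsCellularNetwork

variable {Ω : Type*} [MeasurableSpace Ω] {P : Measure Ω} [IsProbabilityMeasure P]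
  {lam mu : ℝ} {FL FT : Measure ℝ} [IsProbabilityMeasure FL] [IsProbabilityMeasure FT]
  {X C : ℕ → Ω → ℂ} {L T : ℕ → Ω → ℝ}

/-- If the probability that one of the links is line-of-sight given the nearest stations depends
only on the distances and on the angles relative to the last station, then its mean is the
averaged inclusion-exclusion sum. -/
theorem integrableOn_and_toReal_lintegral_eq (hnet : IsCellularNetwork P lam mu FL FT X C L T)
    (hlam : 0 < lam) (hmu : 0 < mu)
    (hFL : ∀ᵐ ℓ ∂FL, 0 ≤ ℓ) (hmean : Integrable (fun ℓ : ℝ => ℓ) FL)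
    (hFT : ∀ᵐ θ ∂FT, θ ∈ Set.Icc 0 Real.pi) {m : ℕ} {F : (Fin (m + 1) → ℂ) → ℝ≥0∞}
    (hF : Measurable F) (hF1 : ∀ x, F x ≤ 1)
    (hFk : ∀ s φ : Fin (m + 1) → ℝ, (∀ i, 0 < s i) → F (fun i => (s i : ℂ) * unitVec (φ i)) =
      P (⋃ i, {ω | IsLOS ((s i : ℂ) * unitVec (φ i - φ (Fin.last m)))
        (fun k => C k ω) (fun k => L k ω) (fun k => T k ω)})) :
    IntegrableOn (fun q : (Fin (m + 1 - 1) → ℝ) × (Fin (m + 1) → ℝ) =>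
      inclExclSum mu FL FT q.2 (extendAngles q.1) * distanceDensity lam m.succ_pos q.2)
      (angleBox (m + 1) ×ˢ positiveOrthant (m + 1)) ∧
    (∫⁻ ω, F (fun i => X i ω) ∂P).toReal = averagedSum lam mu FL FT m.succ_pos := by
  set g : (Fin (m + 1 - 1) → ℝ) × (Fin (m + 1) → ℝ) → ℝ := fun q =>
    inclExclSum mu FL FT q.2 (extendAngles q.1) * distanceDensity lam m.succ_pos q.2 with hg
  have hgm : Measurable g :=
    ((measurable_inclExclSum hFL hFT mu (m + 1)).comp (measurable_snd.prodMk
      ((measurable_extendAngles (m + 1)).comp measurable_fst))).mul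
      ((measurable_distanceDensity lam m.succ_pos).comp measurable_snd)
  -- The signed sum is nonnegative because it is a probability; this allows Tonelli.
  have hK0 : ∀ r φ : Fin (m + 1) → ℝ, 0 ≤ inclExclSum mu FL FT r φ := fun r φ => by
    rw [← hnet.measureReal_iUnion_isLOS hmu hFL hmean hFT]
    exact measureReal_nonneg
  have hset : MeasurableSet (angleBox (m + 1) ×ˢ positiveOrthant (m + 1)) := by
    refine (MeasurableSet.univ_pi fun _ => measurableSet_Icc).prod ?_
    simp only [positiveOrthant, Set.ofPred_forall]
    exact MeasurableSet.iInter fun i => measurableSet_lt measurable_const (measurable_pi_apply i)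
  have hlint : ∫⁻ q in angleBox (m + 1) ×ˢ positiveOrthant (m + 1), ENNReal.ofReal (g q) =
      ENNReal.ofReal (2 * Real.pi) ^ m * ∫⁻ ω, F (fun i => X i ω) ∂P := by
    rw [hnet.lintegral_stations hlam hF (hnet.measurable_measure_iUnion_isLOS (m + 1)) hFk]
    refine setLIntegral_congr_fun hset fun q hq => ?_
    beta_reduce
    rw [hnet.measure_iUnion_isLOS hmu hFL hmean hFT, ← ENNReal.ofReal_mul (hK0 _ _)]
  have hF' : ∫⁻ ω, F (fun i => X i ω) ∂P ≠ ∞ := by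
    refine ne_top_of_le_ne_top ENNReal.one_ne_top ((lintegral_mono fun ω => hF1 _).trans ?_)
    simp
  have hg0 : 0 ≤ᵐ[volume.restrict (angleBox (m + 1) ×ˢ positiveOrthant (m + 1))] g := by
    filter_upwards [ae_restrict_mem hset] with q hq
    exact mul_nonneg (hK0 _ _) (distanceDensity_nonneg hlam m.succ_pos hq.2)
  -- Absolute convergence costs no estimate: the integral is `(2π)^m` times the mean of a function
  -- bounded by 1.
  have hint : IntegrableOn g (angleBox (m + 1) ×ˢ positiveOrthant (m + 1)) := by
    refine (lintegral_ofReal_ne_top_iff_integrable hgm.aestronglyMeasurable hg0).1 ?_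
    rw [hlint]
    exact ENNReal.mul_ne_top (ENNReal.pow_ne_top ENNReal.ofReal_ne_top) hF'
  refine ⟨hint, ?_⟩
  have h2 := setIntegral_prod (μ := volume) (ν := volume) g hint
  rw [← Measure.volume_eq_prod, integral_eq_lintegral_of_nonneg_ae hg0 hgm.aestronglyMeasurable,
    hlint, ENNReal.toReal_mul, ENNReal.toReal_pow, ENNReal.toReal_ofReal Real.two_pi_pos.le] at h2
  rw [averagedSum, ← h2, Nat.succ_sub_one]
  field_simp

end IsCellularNetwork

theorem theorem4 {Ω : Type*} [MeasurableSpace Ω] (P : Measure Ω) [IsProbabilityMeasure P]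
    (lam mu : ℝ) (hlam : 0 < lam) (hmu : 0 < mu)
    (FL FT : Measure ℝ) [IsProbabilityMeasure FL] [IsProbabilityMeasure FT]
    (hFL : ∀ᵐ ℓ ∂FL, 0 ≤ ℓ) (hmean : Integrable (fun ℓ : ℝ => ℓ) FL)
    (hFT : ∀ᵐ θ ∂FT, θ ∈ Set.Icc 0 Real.pi)
    (X C : ℕ → Ω → ℂ) (L T : ℕ → Ω → ℝ)
    (hnet : IsCellularNetwork P lam mu FL FT X C L T)
    (n : ℕ) (hn : 0 < n) :
    -- the integrals that define the mean area and the average exist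
    (∀ (S : Finset (Fin n)) (r φ : Fin n → ℝ),
      Integrable (fun p : ℝ × ℝ => unionArea S r φ p.1 p.2) (FL.prod FT)) ∧
    IntegrableOn (fun q : (Fin (n - 1) → ℝ) × (Fin n → ℝ) =>
      inclExclSum mu FL FT q.2 (extendAngles q.1) * distanceDensity lam hn q.2)
      (angleBox n ×ˢ positiveOrthant n) ∧
    -- the reliability, with the base stations placed so that the `n`-th one is on the `x`-axis
    reliability P n (fun i ω => rotateToAxis (X (n - 1) ω) (X i ω)) C L T =
      averagedSum lam mu FL FT hn ∧
    -- for isotropic blockages this placement is not needed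
    (FT = ProbabilityTheory.cond volume (Set.Icc 0 Real.pi) →
      reliability P n X C L T = averagedSum lam mu FL FT hn) := by
  obtain ⟨m, rfl⟩ := Nat.exists_eq_add_one_of_ne_zero hn.ne'
  have hXm : Measurable fun ω (i : ℕ) => X i ω :=
    measurable_pi_lambda _ fun i => hnet.stations.measurable i
  have hk := hnet.measurable_measure_iUnion_isLOS (m + 1)
  have hrot : Measurable fun (x : ℕ → ℂ) (i : ℕ) => rotateToAxis (x m) (x i) :=
    measurable_pi_lambda _ fun i => Measurable.comp (f := fun x : ℕ → ℂ => (x m, x i))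
      measurable_rotateToAxis (by fun_prop)
  have hrot' : Measurable fun (x : Fin (m + 1) → ℂ) i => rotateToAxis (x (Fin.last m)) (x i) :=
    measurable_pi_lambda _ fun i =>
      Measurable.comp (f := fun x : Fin (m + 1) → ℂ => (x (Fin.last m), x i))
        measurable_rotateToAxis (by fun_prop)
  have hmain := hnet.integrableOn_and_toReal_lintegral_eq hlam hmu hFL hmean hFT
    (hk.comp hrot') (fun _ => prob_le_one) (fun s φ hs => by
      simp only [Function.comp_apply, rotateToAxis_mul_unitVec (hs (Fin.last m))])
  refine ⟨fun S r φ => integrable_unionArea S hmean r φ, hmain.1, ?_, fun hunif => ?_⟩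
  · rw [← hmain.2]
    exact hnet.reliability_eq_toReal_lintegral (n := m + 1)
      (Y := fun i ω => rotateToAxis (X m ω) (X i ω)) (hrot.comp hXm)
      (hnet.stations_indep_blockages.comp hrot measurable_id)
  -- Here nothing is rotated: the sum at the angles `φ` equals the sum at `φ i - φ (Fin.last m)`, by
  -- isotropy with the shift `φ (Fin.last m)`.
  · have hiso := hnet.integrableOn_and_toReal_lintegral_eq hlam hmu hFL hmean hFT hk
      (fun _ => prob_le_one) (fun s φ hs => by
        rw [hnet.measure_iUnion_isLOS hmu hFL hmean hFT,
          hnet.measure_iUnion_isLOS hmu hFL hmean hFT s (fun i => φ i - φ (Fin.last m)),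
          ← inclExclSum_add_of_uniform hFL hFT hunif mu s (fun i => φ i - φ (Fin.last m))
            (φ (Fin.last m))]
        simp only [sub_add_cancel])
    rw [← hiso.2, hnet.reliability_eq_toReal_lintegral hXm hnet.stations_indep_blockages]
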